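/- Let $u_0:\mathbb R\to\mathbb R$ satisfy $u_0-u_0''+1>0$ on $\mathbb R$, and let $u(x,t)$ be a classical solution for $t\ge 0$ of the Cauchy problem for the Degasperis--Procesi equation $$u_t-u_{txx}+3u_x+4uu_x=3u_xu_{xx}+uu_{xxx}\quad(x\in\mathbb R,\ t>0),\qquad u(x,0)=u_0(x),$$ of class $C^3$ on $\mathbb R\times[0,\infty)$ and such that $u,u_x,u_{xx},u_{xxx}$ are $O((1+x^2)^{-1})$ uniformly for $t$ in compact subsets of $[0,\infty)$. Put $q=(u-u_{xx}+1)^{1/3}$ and, for $k\in\mathbb C\setminus\{0\}$ and $j=1,2,3$, $$\lambda_j(k)=\tfrac1{\sqrt3}\Bigl(\omega^jk+\frac1{\omega^jk}\Bigr),\quad \omega=e^{2\pi i/3},\qquad P=\begin{pmatrix}1&1&1\\ \lambda_1&\lambda_2&\lambda_3\\ \lambda_1^2&\lambda_2^2&\lambda_3^2\end{pmatrix},\qquad \hat U=P^{-1}\begin{pmatrix}q_x/q&0&0\\0&0&0\\0&1/q-q&-q_x/q\end{pmatrix}P .$$ Let $\Sigma=\{0\}\cup\{k\ne 0:\operatorname{Re}\lambda_j(k)=\operatorname{Re}\lambda_l(k)\text{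 for some }j\ne l\}$, which is the union of the six closed rays $[0,\infty)e^{i\pi(\nu-1)/3}$, $\nu=1,\dots,6$. For $t\ge0$ and $k\in\mathbb C\setminus\Sigma$ consider the system of integral equations, $1\le j,l\le3$, $$M_{jl}(x,t,k)=I_{jl}+\int_{\infty_{jl}}^x e^{-\lambda_j(k)\int_x^\xi q(\zeta,t)\,d\zeta}\,(\hat UM)_{jl}(\xi,t,k)\,e^{\lambda_l(k)\int_x^\xi q(\zeta,t)\,d\zeta}\,d\xi,\qquad x\in\mathbb R,$$ where $\infty_{jl}=+\infty$ if $\operatorname{Re}\lambda_j(k)\ge\operatorname{Re}\lambda_l(k)$ and $\infty_{jl}=-\infty$ if $\operatorname{Re}\lambda_j(k)<\operatorname{Re}\lambda_l(k)$, for a $3\times3$ matrix function $M(\cdot,t,k)$ that is bounded and continuous on $\mathbb R$. Then for every $t\ge0$: (i) The set $Z_t$ of those $k\in\mathbb C\setminus\Sigma$ for which the system does not have exactly one such solution has no accumulation point in $\mathbb C\setminus\Sigma$, and for every $x\in\mathbb R$ the solution $M(x,t,k)$, $k\in\mathbb C\setminus(\Sigma\cup Z_t)$, is piecewise meromorphic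 with respect to $\Sigma$, that is, its entries are meromorphic functions of $k$ on $\mathbb C\setminus\Sigma$. (ii) The set $Z_t$ is bounded, and for every $x\in\mathbb R$, $M(x,t,k)\to I$ as $k\to\infty$ in $\mathbb C\setminus\Sigma$, where $I$ is the $3\times3$ identity matrix. -/

import Mathlib

open MeasureTheory Filter Topology Set

namespace DegasperisProcesi

noncomputable section

/-! ### The Degasperis-Procesi Cauchy problem (with `ω = 1`) -/

/-- The `n`-th derivative of `u(x,t)` with respect to `x`. -/
def dx (n : ℕ) (u : ℝ → ℝ → ℝ) (x t : ℝ) : ℝ :=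
  iteratedDeriv n (fun y => u y t) x

/-- `u(x,t)` is a classical solution, for all times `t ≥ 0`, of the Cauchy problem
`u_t - u_txx + 3 u_x + 4 u u_x = 3 u_x u_xx + u u_xxx`, `u(x,0) = u₀(x)`.
It is of class `C³` on `ℝ × [0,∞)`, and `u` and its first three `x`-derivatives are
`O((1 + x²)⁻¹)`, locally uniformly in `t`. (Since `u` is `C³`, the mixed derivative `u_txx` is
the same in every order; it is written `∂_t (u_xx)`.) -/
structure IsSolution (u₀ : ℝ → ℝ) (u : ℝ → ℝ → ℝ) : Prop where
  smooth : ContDiffOn ℝ 3 (fun p : ℝ × ℝ => u p.1 p.2) (univ ×ˢ Ici 0)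
  decay : ∀ T : ℝ, ∃ C : ℝ, ∀ n ≤ 3, ∀ x : ℝ, ∀ t ∈ Icc 0 T, |dx n u x t| ≤ C / (1 + x ^ 2)
  initial : ∀ x : ℝ, u x 0 = u₀ x
  equation : ∀ x t : ℝ, 0 < t →
    deriv (fun s => u x s) t - deriv (fun s => dx 2 u x s) t + 3 * dx 1 u x t
        + 4 * u x t * dx 1 u x t
      = 3 * dx 1 u x t * dx 2 u x t + u x t * dx 3 u x t

/-- The momentum `m = u - u_xx`. -/
def momentum (u : ℝ → ℝ → ℝ) (x t : ℝ) : ℝ := u x t - dx 2 u x t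

/-- `q = (m + 1)^{1/3}`. -/
def q (u : ℝ → ℝ → ℝ) (x t : ℝ) : ℝ := (momentum u x t + 1) ^ (1 / 3 : ℝ)

/-- The `x`-derivative of `q`. -/
def qx (u : ℝ → ℝ → ℝ) (x t : ℝ) : ℝ := deriv (fun y => q u y t) x

/-! ### The spectral data. The index `j : Fin 3` stands for `j + 1 ∈ {1, 2, 3}`. -/

/-- The cube root of unity `e^{2πi/3}`. -/
def cubeRoot : ℂ := Complex.exp (2 * Real.pi * Complex.I / 3)

/-- `λ_j(k) = (ω^j k + 1/(ω^j k)) / √3`, where `ω = e^{2πi/3}`. -/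
def lam (j : Fin 3) (k : ℂ) : ℂ :=
  (cubeRoot ^ (j.val + 1) * k + (cubeRoot ^ (j.val + 1) * k)⁻¹) / (Real.sqrt 3 : ℂ)

/-- The contour `Σ = {k | Re λ_j(k) = Re λ_l(k) for some j ≠ l}`: the union of the six closed
rays `arg k ∈ (π/3)ℤ`. The origin belongs to it, as `lam j 0 = 0` for all `j`. -/
def contour : Set ℂ := {k | ∃ j l : Fin 3, j ≠ l ∧ (lam j k).re = (lam l k).re}

/-- `P(k)`, with the rows `(1, 1, 1)`, `(λ₁, λ₂, λ₃)` and `(λ₁², λ₂², λ₃²)`. -/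
def P (k : ℂ) : Matrix (Fin 3) (Fin 3) ℂ := Matrix.of fun i j => lam j k ^ i.val

/-- The matrix `Ũ⁽¹⁾(x,t)`. -/
def Utilde (u : ℝ → ℝ → ℝ) (x t : ℝ) : Matrix (Fin 3) (Fin 3) ℝ :=
  !![qx u x t / q u x t, 0, 0;
     0, 0, 0;
     0, 1 / q u x t - q u x t, -(qx u x t / q u x t)]

/-- `Û(x,t,k) = P⁻¹(k) Ũ⁽¹⁾(x,t) P(k)`. -/
def Uhat (u : ℝ → ℝ → ℝ) (x t : ℝ) (k : ℂ) : Matrix (Fin 3) (Fin 3) ℂ :=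
  (P k)⁻¹ * (Utilde u x t).map (fun r : ℝ => (r : ℂ)) * P k

/-! ### The system of integral equations -/

/-- The integral of `f` from `∞_{jl}` to `x`, where `∞_{jl} = +∞` if `Re λ_j ≥ Re λ_l`, and
`∞_{jl} = -∞` if `Re λ_j < Re λ_l`. -/
def integralFromInfty (j l : Fin 3) (k : ℂ) (f : ℝ → ℂ) (x : ℝ) : ℂ :=
  open Classical in
  if (lam j k).re ≥ (lam l k).re then -∫ ξ in Ioi x, f ξ else ∫ ξ in Iic x, f ξ

/-- `N = M(·,t,k)` is a bounded continuous solution of the system of integral equations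
`M_jl(x) = I_jl + ∫_{∞_jl}^x e^{-λ_j ∫_x^ξ q dζ} (Û M)_jl(ξ) e^{λ_l ∫_x^ξ q dζ} dξ`. -/
structure SolvesIntegralSystem (u : ℝ → ℝ → ℝ) (t : ℝ) (k : ℂ)
    (N : ℝ → Matrix (Fin 3) (Fin 3) ℂ) : Prop where
  continuous : Continuous N
  bounded : ∃ C : ℝ, ∀ x j l, ‖N x j l‖ ≤ C
  equation : ∀ x j l, N x j l = (1 : Matrix (Fin 3) (Fin 3) ℂ) j l +
    integralFromInfty j l k (fun ξ =>
      Complex.exp (-lam j k * ((∫ ζ in x..ξ, q u ζ t : ℝ) : ℂ)) * (Uhat u ξ t k * N ξ) j l *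
        Complex.exp (lam l k * ((∫ ζ in x..ξ, q u ζ t : ℝ) : ℂ))) x

/-- The system has exactly one bounded continuous solution at `(t, k)`. -/
def UniquelySolvable (u : ℝ → ℝ → ℝ) (t : ℝ) (k : ℂ) : Prop :=
  ∃! N : ℝ → Matrix (Fin 3) (Fin 3) ℂ, SolvesIntegralSystem u t k N

/-- `M(x,t,k)` is the solution of the system for every `t ≥ 0` and every `k` off the contour for
which the system is uniquely solvable. (Its values at other `k` are immaterial.) -/
def IsEigenfunction (u : ℝ → ℝ → ℝ) (M : ℝ → ℝ → ℂ → Matrix (Fin 3) (Fin 3) ℂ) : Prop :=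
  ∀ t : ℝ, 0 ≤ t → ∀ k ∈ contourᶜ, UniquelySolvable u t k →
    SolvesIntegralSystem u t k (fun x => M x t k)

/-- A matrix function of `k` is piecewise meromorphic with respect to a contour if it is
meromorphic (entrywise) off the contour. -/
def IsPiecewiseMeromorphic (Γ : Set ℂ) (F : ℂ → Matrix (Fin 3) (Fin 3) ℂ) : Prop :=
  ∀ j l, MeromorphicOn (fun k => F k j l) Γᶜ

end

end DegasperisProcesi

namespace DegasperisProcesi

/-! ### Regularity and positivity of the momentum density -/

/-! Fix `t`, put `y(x) = ∫₀ˣ q`, `p = q_x/q` and `r = 1/q - q`. The system decouples into columns.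
Column `c` reads `f = e_c + K_c(k) f` on triples of bounded continuous functions. In row `j`,
`K_c(k)` integrates `p f_l` and `r f_l`, with `k`-dependent coefficients, against
`e^{α(y(ξ)-y(x))}`, `α = λ_c - λ_j`, cut off to the half-line where it is bounded. The coefficients
`p`, `r` are integrable because `m + 1` stays bounded below by a positive constant, by a minimum
principle for the transport equation it satisfies (`exists_momentum_lower_bound`).

Off the contour either `α = 0` or `Re α ≠ 0`. The kernel then has limits at `±∞`, so `K_c(k)` is a
norm limit of finite rank operators (`columnOp_mem_finiteRankLimits`), and it is analytic in `k`
(`analyticAt_columnOp`). Locally `1 - K_c(k)` therefore has an inverse `G(k)/d(k)` with `G`, `d`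
analytic, as long as `d` is not identically zero (`exists_analytic_inverse`).

Large `k` is the delicate case: `K_c(k)` need not become small in norm, since the off-diagonal
coefficients of `p` are only bounded, and `Re α` may be arbitrarily small near the contour. But a
solution obeys `f_l' = -(λ_c - λ_l) q f_l + ...`, so integrating by parts in the term containing
`f_l` gains the factor `1/(λ_l - λ_j)`, which is `O(1/k)` for `j ≠ l`, uniformly up to the contour.
Hence `‖K_c f‖ ≤ ε‖f‖` for solutions `f` of `f = a e_c + K_c f` (`exists_norm_columnOp_le`). With `a
= 0` this gives injectivity, hence unique solvability; with `a = 1` it gives `M → I`.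

Finally, the ray through `k₀` from `k₀` to infinity stays off the contour. Invertibility at its far
end propagates along it by connectedness (`eventually_isUnit_of_path`), so `d` never vanishes
identically, and solvability fails only at isolated points, where `M` is meromorphic. -/

theorem exists_hasDerivAt_slice {F : ℝ × ℝ → ℝ} {m n : WithTop ℕ∞} (hmn : m + 1 ≤ n)
    (hF : ContDiffOn ℝ n F (univ ×ˢ Ici 0)) :
    ∃ G : ℝ × ℝ → ℝ, ContDiffOn ℝ m G (univ ×ˢ Ici 0) ∧
      ∀ x t : ℝ, 0 ≤ t → HasDerivAt (fun y => F (y, t)) (G (x, t)) x := by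
  have hu : UniqueDiffOn ℝ ((univ : Set ℝ) ×ˢ Ici (0 : ℝ)) :=
    uniqueDiffOn_univ.prod (uniqueDiffOn_Ici 0)
  refine ⟨fun p => fderivWithin ℝ F (univ ×ˢ Ici 0) p (1, 0),
    (hF.fderivWithin hu hmn).clm_apply contDiffOn_const, fun x t ht => ?_⟩
  have hn : n ≠ 0 := by
    rintro rfl
    simp at hmn
  have h1 : HasFDerivWithinAt F (fderivWithin ℝ F (univ ×ˢ Ici 0) (x, t)) (univ ×ˢ Ici 0) (x, t) :=
    (hF.differentiableOn hn (x, t) (mk_mem_prod (mem_univ _) ht)).hasFDerivWithinAt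
  have h2 : HasDerivWithinAt (fun y : ℝ => (y, t)) ((1 : ℝ), (0 : ℝ)) univ x :=
    ((hasDerivAt_id x).prodMk (hasDerivAt_const x t)).hasDerivWithinAt
  have h3 := h1.comp_hasDerivWithinAt x h2 (fun y _ => mk_mem_prod (mem_univ y) ht)
  exact hasDerivWithinAt_univ.mp h3

theorem dx_succ (n : ℕ) (u : ℝ → ℝ → ℝ) (x t : ℝ) :
    dx (n + 1) u x t = deriv (fun y => dx n u y t) x := by
  simp only [dx, iteratedDeriv_succ]

theorem dx_zero (u : ℝ → ℝ → ℝ) (x t : ℝ) : dx 0 u x t = u x t := by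
  simp [dx]

theorem contDiffOn_dx_succ {n : ℕ} {a b : WithTop ℕ∞} (hab : a + 1 ≤ b) {u : ℝ → ℝ → ℝ}
    (h : ContDiffOn ℝ b (fun p : ℝ × ℝ => dx n u p.1 p.2) (univ ×ˢ Ici 0)) :
    ContDiffOn ℝ a (fun p : ℝ × ℝ => dx (n + 1) u p.1 p.2) (univ ×ˢ Ici 0) ∧
      ∀ x t : ℝ, 0 ≤ t → HasDerivAt (fun y => dx n u y t) (dx (n + 1) u x t) x := by
  obtain ⟨G, hG, hd⟩ := exists_hasDerivAt_slice hab h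
  have he : ∀ x t : ℝ, 0 ≤ t → dx (n + 1) u x t = G (x, t) := fun x t ht => by
    rw [dx_succ]; exact (hd x t ht).deriv
  exact ⟨hG.congr fun p hp => he p.1 p.2 hp.2, fun x t ht => by rw [he x t ht]; exact hd x t ht⟩

namespace IsSolution

variable {u₀ : ℝ → ℝ} {u : ℝ → ℝ → ℝ}

theorem contDiffOn_dx (hu : IsSolution u₀ u) :
    ContDiffOn ℝ 2 (fun p : ℝ × ℝ => dx 1 u p.1 p.2) (univ ×ˢ Ici 0) ∧
    ContDiffOn ℝ 1 (fun p : ℝ × ℝ => dx 2 u p.1 p.2) (univ ×ˢ Ici 0) ∧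
    ContDiffOn ℝ 0 (fun p : ℝ × ℝ => dx 3 u p.1 p.2) (univ ×ˢ Ici 0) ∧
    (∀ x t : ℝ, 0 ≤ t → HasDerivAt (fun y => u y t) (dx 1 u x t) x) ∧
    (∀ x t : ℝ, 0 ≤ t → HasDerivAt (fun y => dx 1 u y t) (dx 2 u x t) x) ∧
    (∀ x t : ℝ, 0 ≤ t → HasDerivAt (fun y => dx 2 u y t) (dx 3 u x t) x) := by
  have h0 : ContDiffOn ℝ 3 (fun p : ℝ × ℝ => dx 0 u p.1 p.2) (univ ×ˢ Ici 0) := by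
    simpa only [dx_zero] using hu.smooth
  obtain ⟨h1, d1⟩ := contDiffOn_dx_succ (a := 2) (by norm_num) h0
  obtain ⟨h2, d2⟩ := contDiffOn_dx_succ (a := 1) (by norm_num) h1
  obtain ⟨h3, d3⟩ := contDiffOn_dx_succ (a := 0) (by norm_num) h2
  exact ⟨h1, h2, h3, by simpa only [dx_zero] using d1, d2, d3⟩

theorem contDiffOn_momentum (hu : IsSolution u₀ u) :
    ContDiffOn ℝ 1 (fun p : ℝ × ℝ => momentum u p.1 p.2 + 1) (univ ×ˢ Ici 0) :=
  ((hu.smooth.of_le (by norm_num)).sub hu.contDiffOn_dx.2.1).add contDiffOn_const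

theorem hasDerivAt_momentum (hu : IsSolution u₀ u) (x : ℝ) {t : ℝ} (ht : 0 ≤ t) :
    HasDerivAt (fun y => momentum u y t + 1) (dx 1 u x t - dx 3 u x t) x := by
  obtain ⟨-, -, -, d1, -, d3⟩ := hu.contDiffOn_dx
  exact ((d1 x t ht).sub (d3 x t ht)).add_const 1

/-- In terms of `w = m + 1` the equation is the transport equation `w_t + u w_x + 3 u_x w = 0`. -/
theorem hasDerivAt_momentum_time (hu : IsSolution u₀ u) (x : ℝ) {t : ℝ} (ht : 0 < t) :
    HasDerivAt (fun s => momentum u x s + 1)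
      (-(u x t * (dx 1 u x t - dx 3 u x t)) - 3 * dx 1 u x t * (momentum u x t + 1)) t := by
  have hS : (univ : Set ℝ) ×ˢ Ici (0 : ℝ) ∈ 𝓝 (x, t) := prod_mem_nhds univ_mem (Ici_mem_nhds ht)
  have key : ∀ F : ℝ × ℝ → ℝ, ContDiffOn ℝ 1 F (univ ×ˢ Ici 0) →
      DifferentiableAt ℝ (fun s => F (x, s)) t := fun F hF =>
    DifferentiableAt.comp t (((hF.differentiableOn (by norm_num)) (x, t)
      ⟨mem_univ _, ht.le⟩).differentiableAt hS) (by fun_prop)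
  have h1 := (key _ (hu.smooth.of_le (by norm_num))).hasDerivAt
  have h2 := (key _ hu.contDiffOn_dx.2.1).hasDerivAt
  refine ((h1.sub h2).add_const 1).congr_deriv ?_
  have := hu.equation x t ht
  simp only [momentum]
  linear_combination this

theorem exists_decay (hu : IsSolution u₀ u) (T : ℝ) : ∃ C : ℝ, 0 ≤ C ∧
    ∀ n ≤ 3, ∀ x : ℝ, ∀ t ∈ Icc 0 T, |dx n u x t| ≤ C / (1 + x ^ 2) := by
  obtain ⟨C, hC⟩ := hu.decay T
  refine ⟨|C|, abs_nonneg C, fun n hn x t ht => (hC n hn x t ht).trans ?_⟩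
  gcongr
  exact le_abs_self C

/-- A minimum principle: where `w = m + 1` is minimal in `x`, the transport term drops out and `w_t
= -3 u_x w` with `u_x` bounded, so `w` cannot decay faster than exponentially. For large `|x|` the
decay of `u` and `u_xx` keeps `w` near `1`, which reduces everything to a compact rectangle. -/
theorem exists_momentum_lower_bound (hu : IsSolution u₀ u)
    (hpos : ∀ x : ℝ, 0 < u₀ x - iteratedDeriv 2 u₀ x + 1) {T : ℝ} (hT : 0 ≤ T) :
    ∃ c : ℝ, 0 < c ∧ ∀ x : ℝ, c ≤ momentum u x T + 1 := by
  obtain ⟨C, hC0, hC⟩ := hu.exists_decay T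
  have hcont := hu.contDiffOn_momentum.continuousOn
  have hfar : ∀ x : ℝ, 4 * C ≤ |x| → ∀ t ∈ Icc 0 T, 1 / 2 ≤ momentum u x t + 1 := by
    intro x hx t ht
    have h0 := hC 0 (by norm_num) x t ht
    have h2 := hC 2 (by norm_num) x t ht
    rw [dx_zero] at h0
    have h3 : C / (1 + x ^ 2) ≤ 1 / 4 := by
      rw [div_le_iff₀ (by positivity)]
      nlinarith [sq_abs x, sq_nonneg (|x| - 1), abs_nonneg x]
    rw [momentum]
    linarith [abs_le.mp h0, abs_le.mp h2, (abs_le.mp h0).1, (abs_le.mp h2).2]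
  have hinit : ∀ x, 0 < momentum u x 0 + 1 := by
    intro x
    have he : (fun y => u y 0) = u₀ := funext hu.initial
    rw [momentum, dx, he, hu.initial]
    exact hpos x
  have h0cont : Continuous fun x => momentum u x 0 + 1 := by
    have : Continuous fun x : ℝ => (x, (0 : ℝ)) := by fun_prop
    exact hcont.comp_continuous this fun x => ⟨mem_univ _, self_mem_Ici⟩
  obtain ⟨x₁, -, hx₁⟩ := (isCompact_Icc (a := -(4 * C)) (b := 4 * C)).exists_isMinOn
    (nonempty_Icc.mpr (by linarith)) h0cont.continuousOn
  obtain ⟨δ, hδ0, hδ⟩ : ∃ δ : ℝ, 0 < δ ∧ δ < 1 / 2 ∧ ∀ x, δ < momentum u x 0 + 1 := by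
    refine ⟨min (1 / 4) ((momentum u x₁ 0 + 1) / 2), lt_min (by norm_num) (by linarith [hinit x₁]),
      (min_le_left _ _).trans_lt (by norm_num), fun x => ?_⟩
    rcases le_total (4 * C) |x| with h | h
    · have := hfar x h 0 ⟨le_rfl, hT⟩
      linarith [min_le_left (1 / 4) ((momentum u x₁ 0 + 1) / 2)]
    · have := hx₁ (abs_le.mp h)
      simp only [mem_ofPred_eq] at this
      linarith [min_le_right (1 / 4) ((momentum u x₁ 0 + 1) / 2), hinit x₁]
  -- Since `|u_x| ≤ C`, this choice gives `0 < 3 u_x + K < 2K`. At a negative minimum of `e^{-Kt} w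
  -- - δ e^{-2Kt}` it forces a strictly positive time derivative.
  set K : ℝ := 3 * C + 1 with hK
  have hK0 : 0 < K := by positivity
  have main : ∀ x, ∀ t ∈ Icc 0 T,
      0 ≤ Real.exp (-K * t) * (momentum u x t + 1) - δ * Real.exp (-(2 * K) * t) := by
    by_contra! hneg
    obtain ⟨x₂, t₂, ht₂, hneg⟩ := hneg
    set Y : ℝ × ℝ → ℝ := fun p =>
      Real.exp (-K * p.2) * (momentum u p.1 p.2 + 1) - δ * Real.exp (-(2 * K) * p.2) with hY
    have hYc : ContinuousOn Y (univ ×ˢ Ici 0) := by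
      refine ContinuousOn.sub (ContinuousOn.mul ?_ hcont) ?_ <;> fun_prop
    have hYfar : ∀ x : ℝ, 4 * C ≤ |x| → ∀ t ∈ Icc 0 T, 0 ≤ Y (x, t) := by
      intro x hx t ht
      have h1 := hfar x hx t ht
      have h2 : Real.exp (-(2 * K) * t) ≤ Real.exp (-K * t) :=
        Real.exp_le_exp.mpr (by nlinarith [mul_nonneg hK0.le ht.1])
      have h3 := Real.exp_pos (-K * t)
      simp only [hY]
      nlinarith [hδ.1]
    have hx₂ : |x₂| ≤ 4 * C := by
      by_contra! h
      exact absurd (hYfar x₂ h.le t₂ ht₂) (not_le.mpr hneg)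
    obtain ⟨⟨x₀, t₀⟩, hp₀, hmin⟩ :=
      ((isCompact_Icc (a := -(4 * C)) (b := 4 * C)).prod
        (isCompact_Icc (a := (0 : ℝ)) (b := T))).exists_isMinOn
        ⟨(x₂, t₂), abs_le.mp hx₂, ht₂⟩
        (hYc.mono (prod_mono (subset_univ _) (fun s hs => hs.1)))
    have hYneg : Y (x₀, t₀) < 0 :=
      lt_of_le_of_lt (hmin (show (x₂, t₂) ∈ _ from ⟨abs_le.mp hx₂, ht₂⟩)) hneg
    have hglob : ∀ x, ∀ t ∈ Icc 0 T, Y (x₀, t₀) ≤ Y (x, t) := by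
      intro x t ht
      rcases le_total (4 * C) |x| with h | h
      · exact hYneg.le.trans (hYfar x h t ht)
      · exact hmin (show (x, t) ∈ _ from ⟨abs_le.mp h, ht⟩)
    have ht₀ : 0 < t₀ := by
      rcases hp₀.2.1.eq_or_lt with h | h
      · exfalso
        simp only at h
        rw [← h] at hYneg
        simp only [hY, mul_zero, Real.exp_zero] at hYneg
        linarith [hδ.2 x₀]
      · exact h
    have ht₀T : t₀ ∈ Icc 0 T := hp₀.2
    have hwx := hu.hasDerivAt_momentum x₀ ht₀.le
    have hYx : HasDerivAt (fun x => Y (x, t₀))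
        (Real.exp (-K * t₀) * (dx 1 u x₀ t₀ - dx 3 u x₀ t₀)) x₀ :=
      (hwx.const_mul (Real.exp (-K * t₀))).sub_const (δ * Real.exp (-(2 * K) * t₀))
    have hx0 : dx 1 u x₀ t₀ - dx 3 u x₀ t₀ = 0 := by
      have : IsLocalMin (fun x => Y (x, t₀)) x₀ :=
        Filter.Eventually.of_forall fun x => hglob x t₀ ht₀T
      have := this.hasDerivAt_eq_zero hYx
      exact (mul_eq_zero.mp this).resolve_left (Real.exp_pos _).ne'
    have hwt := hu.hasDerivAt_momentum_time x₀ ht₀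
    rw [hx0, mul_zero, neg_zero, zero_sub] at hwt
    have he : ∀ a : ℝ, HasDerivAt (fun s => Real.exp (a * s)) (Real.exp (a * t₀) * a) t₀ :=
      fun a => by simpa using ((hasDerivAt_id t₀).const_mul a).exp
    have hYt := ((he (-K)).mul hwt).sub ((he (-(2 * K))).const_mul δ)
    set w := momentum u x₀ t₀ + 1
    set e₁ := Real.exp (-K * t₀)
    set e₂ := Real.exp (-(2 * K) * t₀)
    -- The minimum may lie on the edge `t₀ = T`, so only slopes from the left are used.
    have hle : e₁ * -K * w + e₁ * -(3 * dx 1 u x₀ t₀ * w) - δ * (e₂ * -(2 * K)) ≤ 0 := by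
      refine le_of_tendsto ((hasDerivWithinAt_iff_tendsto_slope' self_notMem_Iio).mp
        (hYt.hasDerivWithinAt (s := Iio t₀))) ?_
      filter_upwards [Ioo_mem_nhdsLT ht₀] with s hs
      rw [slope_def_field]
      refine div_nonpos_of_nonneg_of_nonpos (sub_nonneg.mpr ?_) (by linarith [hs.2])
      exact hglob x₀ s ⟨hs.1.le, hs.2.le.trans ht₀T.2⟩
    have h1 := hC 1 (by norm_num) x₀ t₀ ht₀T
    have h4 : C / (1 + x₀ ^ 2) ≤ C := div_le_self hC0 (by nlinarith [sq_nonneg x₀])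
    have h5 := abs_le.mp (h1.trans h4)
    have h6 : e₁ * w < δ * e₂ := sub_neg.mp hYneg
    have h7 : 0 < δ * e₂ := mul_pos hδ0 (Real.exp_pos _)
    have h8 : 0 < 3 * dx 1 u x₀ t₀ + K := by linarith [h5.1]
    have h9 : 3 * dx 1 u x₀ t₀ + K < 2 * K := by linarith [h5.2]
    nlinarith [mul_lt_mul_of_pos_left h6 h8, mul_lt_mul_of_pos_right h9 h7]
  refine ⟨δ * Real.exp (-K * T), mul_pos hδ0 (Real.exp_pos _), fun x => ?_⟩
  have h1 := main x T ⟨hT, le_rfl⟩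
  have h2 : Real.exp (-(2 * K) * T) = Real.exp (-K * T) * Real.exp (-K * T) := by
    rw [← Real.exp_add]; ring_nf
  rw [h2] at h1
  have h3 := Real.exp_pos (-K * T)
  by_contra! h4
  nlinarith [mul_lt_mul_of_pos_left h4 h3]

end IsSolution

/-! ### Limits of finite rank operators and the analytic Fredholm alternative -/

section Fredholm

variable {X Y Z : Type*} [NormedAddCommGroup X] [NormedSpace ℂ X] [NormedAddCommGroup Y]
  [NormedSpace ℂ Y] [NormedAddCommGroup Z] [NormedSpace ℂ Z]

/-- The operators that are limits in norm of operators of finite rank. -/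
noncomputable def finiteRankLimits (X Y : Type*) [NormedAddCommGroup X] [NormedSpace ℂ X]
    [NormedAddCommGroup Y] [NormedSpace ℂ Y] : Submodule ℂ (X →L[ℂ] Y) :=
  (Submodule.span ℂ {T : X →L[ℂ] Y |
    ∃ (φ : X →L[ℂ] ℂ) (y : Y), T = φ.smulRight y}).topologicalClosure

theorem exists_norm_sub_lt_of_mem_finiteRankLimits {T : X →L[ℂ] Y}
    (hT : T ∈ finiteRankLimits X Y) {ε : ℝ} (hε : 0 < ε) :
    ∃ (n : ℕ) (φ : Fin n → X →L[ℂ] ℂ) (y : Fin n → Y),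
      ‖T - ∑ i, (φ i).smulRight (y i)‖ < ε := by
  obtain ⟨F, hF, hTF⟩ := Metric.mem_closure_iff.mp hT ε hε
  obtain ⟨n, c, g, rfl⟩ := Submodule.mem_span_set'.mp hF
  choose φ y h using fun i => (g i).2
  refine ⟨n, fun i => c i • φ i, y, ?_⟩
  rw [dist_eq_norm] at hTF
  have he : ∑ i, (c i • φ i).smulRight (y i) = ∑ i, c i • (g i : X →L[ℂ] Y) :=
    Finset.sum_congr rfl fun i _ => by
      rw [h i]
      ext f
      simp [mul_smul]
  rwa [he]

theorem mem_finiteRankLimits_of_forall_exists {T : X →L[ℂ] Y}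
    (hT : ∀ ε : ℝ, 0 < ε → ∃ (ι : Type) (_ : Fintype ι) (φ : ι → X →L[ℂ] ℂ) (y : ι → Y),
      ‖T - ∑ i, (φ i).smulRight (y i)‖ ≤ ε) :
    T ∈ finiteRankLimits X Y := by
  refine Metric.mem_closure_iff.mpr fun ε hε => ?_
  obtain ⟨ι, _, φ, y, h⟩ := hT (ε / 2) (half_pos hε)
  refine ⟨∑ i, (φ i).smulRight (y i),
    Submodule.sum_mem _ fun i _ => Submodule.subset_span ⟨φ i, y i, rfl⟩, ?_⟩
  rw [dist_eq_norm]
  linarith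

theorem comp_mem_finiteRankLimits {T : X →L[ℂ] Y} (hT : T ∈ finiteRankLimits X Y)
    (L : Y →L[ℂ] Z) : L.comp T ∈ finiteRankLimits X Z := by
  refine map_mem_closure (f := fun T : X →L[ℂ] Y => L.comp T) (by fun_prop) hT fun F hF => ?_
  induction hF using Submodule.span_induction with
  | mem F h =>
    obtain ⟨φ, y, rfl⟩ := h
    refine Submodule.subset_span ⟨φ, L y, ?_⟩
    ext f
    simp
  | zero => simp
  | add F G _ _ hF hG =>
    beta_reduce at *
    rw [ContinuousLinearMap.comp_add]
    exact Submodule.add_mem _ hF hG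
  | smul c F _ hF =>
    beta_reduce at *
    rw [ContinuousLinearMap.comp_smul]
    exact Submodule.smul_mem _ c hF

theorem mem_finiteRankLimits_comp {T : Y →L[ℂ] Z} (hT : T ∈ finiteRankLimits Y Z)
    (L : X →L[ℂ] Y) : T.comp L ∈ finiteRankLimits X Z := by
  refine map_mem_closure (f := fun T : Y →L[ℂ] Z => T.comp L) (by fun_prop) hT fun F hF => ?_
  induction hF using Submodule.span_induction with
  | mem F h =>
    obtain ⟨φ, y, rfl⟩ := h
    refine Submodule.subset_span ⟨φ.comp L, y, ?_⟩
    ext f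
    simp
  | zero => simp
  | add F G _ _ hF hG =>
    beta_reduce at *
    rw [ContinuousLinearMap.add_comp]
    exact Submodule.add_mem _ hF hG
  | smul c F _ hF =>
    beta_reduce at *
    rw [ContinuousLinearMap.smul_comp]
    exact Submodule.smul_mem _ c hF

/-- Near each point, an analytic family `1 - A k` with `A k₀` a limit of finite rank operators has
an inverse of the form `(d k)⁻¹ • G k` with `d`, `G` analytic, and is not injective where
`d` vanishes. -/
theorem exists_analytic_inverse [CompleteSpace X] {A : ℂ → X →L[ℂ] X} {k₀ : ℂ}
    (hA : AnalyticAt ℂ A k₀) (hfin : A k₀ ∈ finiteRankLimits X X) :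
    ∃ (d : ℂ → ℂ) (G : ℂ → X →L[ℂ] X), AnalyticAt ℂ d k₀ ∧ AnalyticAt ℂ G k₀ ∧
      ∀ᶠ k in 𝓝 k₀, (1 - A k) * G k = d k • 1 ∧ G k * (1 - A k) = d k • 1 ∧
        (d k = 0 → ∃ f : X, f ≠ 0 ∧ A k f = f) := by
  obtain ⟨n, φ, x, hF⟩ := exists_norm_sub_lt_of_mem_finiteRankLimits hfin one_pos
  set F : X →L[ℂ] X := ∑ i, (φ i).smulRight (x i) with hFdef
  have hFapp : ∀ f, F f = ∑ i, φ i f • x i := fun f => by simp [hFdef]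
  -- `1 - A = B - F` with `B` invertible near `k₀` and `F` of finite rank; with `J = B⁻¹` this is `B
  -- (1 - J F)`, so invertibility is decided by the matrix `S` of `1 - J F` on the coefficients of
  -- the `x i`.
  set B : ℂ → X →L[ℂ] X := fun k => 1 - (A k - F) with hB
  have hBan : AnalyticAt ℂ B k₀ := by
    exact analyticAt_const.sub (hA.sub analyticAt_const)
  have hBunit₀ : IsUnit (B k₀) := isUnit_one_sub_of_norm_lt_one hF
  have hBunit : ∀ᶠ k in 𝓝 k₀, IsUnit (B k) :=
    hBan.continuousAt.eventually (Units.nhds hBunit₀.unit)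
  set J : ℂ → X →L[ℂ] X := fun k => Ring.inverse (B k) with hJ
  have hJan : AnalyticAt ℂ J k₀ := AnalyticAt.fun_comp_of_eq (analyticAt_inverse hBunit₀.unit) hBan rfl
  set S : ℂ → Matrix (Fin n) (Fin n) ℂ := fun k =>
    Matrix.of fun i j => (1 : Matrix (Fin n) (Fin n) ℂ) i j - φ i (J k (x j)) with hS
  have hSan : ∀ i j, AnalyticAt ℂ (fun k => S k i j) k₀ := fun i j => by
    have h1 : AnalyticAt ℂ (fun k => J k (x j)) k₀ :=
      ((ContinuousLinearMap.apply ℂ X (x j)).analyticAt _).comp hJan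
    exact analyticAt_const.sub (((φ i).analyticAt _).comp h1)
  have hdet : ∀ s : ℂ → Matrix (Fin n) (Fin n) ℂ, (∀ i j, AnalyticAt ℂ (fun k => s k i j) k₀) →
      AnalyticAt ℂ (fun k => (s k).det) k₀ := fun s hs => by
    simp only [Matrix.det_apply']
    exact Finset.analyticAt_fun_sum _ fun σ _ => analyticAt_const.mul
      (Finset.analyticAt_fun_prod _ fun i _ => hs _ _)
  have hadj : ∀ i j, AnalyticAt ℂ (fun k => (S k).adjugate i j) k₀ := fun i j => by
    simp only [Matrix.adjugate_apply]
    refine hdet _ fun a b => ?_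
    simp only [Matrix.updateRow_apply]
    split_ifs
    · exact analyticAt_const
    · exact hSan a b
  -- By Cramer's rule `R` plays the role of `det S` times `F (1 - J F)⁻¹`, without division.
  set R : ℂ → X →L[ℂ] X := fun k =>
    ∑ i, ∑ j, (S k).adjugate i j • (φ j).smulRight (x i) with hR
  have hRan : AnalyticAt ℂ R k₀ :=
    Finset.analyticAt_fun_sum _ fun i _ => Finset.analyticAt_fun_sum _ fun j _ =>
      (hadj i j).smul analyticAt_const
  have hRapp : ∀ k f, R k f = ∑ i, ((S k).adjugate.mulVec fun j => φ j f) i • x i := by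
    intro k f
    simp [hR, Matrix.mulVec, dotProduct, Finset.sum_smul, mul_smul]
  have hSmul : ∀ k v i, (S k).mulVec v i = v i - φ i (J k (∑ j, v j • x j)) := by
    intro k v i
    simp only [hS, Matrix.mulVec, dotProduct, Matrix.of_apply, sub_mul, Finset.sum_sub_distrib,
      map_sum, map_smul, smul_eq_mul]
    congr 1
    · simp [Matrix.one_apply]
    · exact Finset.sum_congr rfl fun j _ => mul_comm _ _
  have hRJ : ∀ k, R k * (1 - J k * F) = (S k).det • F := by
    intro k
    ext f
    have h1 : (fun j => φ j ((1 - J k * F) f)) = (S k).mulVec fun j => φ j f := by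
      funext j
      rw [hSmul, ← hFapp]
      simp
    rw [mul_apply_eq_comp, hRapp, h1, Matrix.mulVec_mulVec, Matrix.adjugate_mul]
    simp [hFapp, Matrix.smul_mulVec, Finset.smul_sum, mul_smul]
  have hJR : ∀ k, (1 - F * J k) * R k = (S k).det • F := by
    intro k
    ext f
    have h1 : ∀ v : Fin n → ℂ, (1 - F * J k) (∑ i, v i • x i) = ∑ i, (S k).mulVec v i • x i := by
      intro v
      simp only [hSmul, sub_smul, Finset.sum_sub_distrib, sub_apply,
        one_apply_eq_self, mul_apply_eq_comp, hFapp]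
    rw [mul_apply_eq_comp, hRapp, h1, Matrix.mulVec_mulVec, Matrix.mul_adjugate]
    simp [hFapp, Matrix.smul_mulVec, Finset.smul_sum, mul_smul]
  refine ⟨fun k => (S k).det, fun k => (S k).det • J k + J k * R k * J k, hdet S hSan,
    ((hdet S hSan).smul hJan).add ((hJan.mul hRan).mul hJan), hBunit.mono fun k hk => ?_⟩
  have hJB : J k * B k = 1 := Ring.inverse_mul_cancel _ hk
  have hBJ : B k * J k = 1 := Ring.mul_inverse_cancel _ hk
  have hAB : 1 - A k = B k - F := by simp only [hB]; abel
  refine ⟨?_, ?_, fun hd => ?_⟩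
  · have h1 : (B k - F) * J k = 1 - F * J k := by rw [sub_mul, hBJ]
    calc (1 - A k) * ((S k).det • J k + J k * R k * J k)
        = (S k).det • ((B k - F) * J k) + ((B k - F) * J k) * R k * J k := by
          rw [hAB, mul_add, mul_smul_comm]; simp only [mul_assoc]
      _ = (S k).det • 1 := by
          rw [h1, hJR, smul_sub, smul_mul_assoc]; abel
  · have h1 : J k * (B k - F) = 1 - J k * F := by rw [mul_sub, hJB]
    calc ((S k).det • J k + J k * R k * J k) * (1 - A k)
        = (S k).det • (J k * (B k - F)) + J k * (R k * (J k * (B k - F))) := by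
          rw [hAB, add_mul, smul_mul_assoc]; simp only [mul_assoc]
      _ = (S k).det • 1 := by
          rw [h1, hRJ, smul_sub, mul_smul_comm]; abel
  -- A null vector `v` of `S` lifts to the fixed vector `J (∑ v_j x_j)`; it is nonzero because the
  -- functionals `φ i` recover `v` from it.
  · obtain ⟨v, hv, hSv⟩ := Matrix.exists_mulVec_eq_zero_iff.mpr hd
    have hφ : ∀ i, φ i (J k (∑ j, v j • x j)) = v i := fun i => by
      have := congrFun hSv i
      rw [hSmul, Pi.zero_apply, sub_eq_zero] at this
      exact this.symm
    refine ⟨J k (∑ j, v j • x j), fun h0 => hv (funext fun i => ?_), ?_⟩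
    · rw [← hφ i, h0, map_zero, Pi.zero_apply]
    · have h2 : (1 - A k) (J k (∑ j, v j • x j)) = 0 := by
        rw [hAB, sub_apply, ← mul_apply_eq_comp (B k), hBJ, hFapp,
          one_apply_eq_self, sub_eq_zero]
        exact Finset.sum_congr rfl fun i _ => by rw [hφ]
      rw [sub_apply, one_apply_eq_self, sub_eq_zero] at h2
      exact h2.symm

end Fredholm

/-! ### Integral operators with a kernel depending on a phase difference -/

section Kernel

open scoped BoundedContinuousFunction

/-- The operator `f ↦ (x ↦ κ x f)` given by a bounded continuous family of functionals. -/
noncomputable def familyOp {X : Type*} [NormedAddCommGroup X] [NormedSpace ℂ X]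
    (κ : ℝ →ᵇ (X →L[ℂ] ℂ)) : X →L[ℂ] (ℝ →ᵇ ℂ) :=
  LinearMap.mkContinuous
    { toFun := fun f => BoundedContinuousFunction.ofNormedAddCommGroup (fun x => κ x f)
        (by fun_prop) (‖κ‖ * ‖f‖) (fun x => (κ x).le_of_opNorm_le (κ.norm_coe_le_norm x) f)
      map_add' := fun f g => by ext x; simp
      map_smul' := fun c f => by ext x; simp } ‖κ‖
    (fun f => BoundedContinuousFunction.norm_ofNormedAddCommGroup_le _
      (mul_nonneg (norm_nonneg κ) (norm_nonneg f))
      (fun x => (κ x).le_of_opNorm_le (κ.norm_coe_le_norm x) f))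

@[simp]
theorem familyOp_apply {X : Type*} [NormedAddCommGroup X] [NormedSpace ℂ X]
    (κ : ℝ →ᵇ (X →L[ℂ] ℂ)) (f : X) (x : ℝ) : familyOp κ f x = κ x f := rfl

theorem totallyBounded_range_of_tendsto {E : Type*} [PseudoMetricSpace E] {κ : ℝ → E}
    (hκ : Continuous κ) {a b : E} (ha : Tendsto κ atTop (𝓝 a)) (hb : Tendsto κ atBot (𝓝 b)) :
    TotallyBounded (range κ) := by
  refine Metric.totallyBounded_iff.mpr fun ε hε => ?_
  obtain ⟨N, hN⟩ := eventually_atTop.mp (ha.eventually (Metric.ball_mem_nhds a hε))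
  obtain ⟨N', hN'⟩ := eventually_atBot.mp (hb.eventually (Metric.ball_mem_nhds b hε))
  obtain ⟨t, ht, hcov⟩ := Metric.totallyBounded_iff.mp
    ((isCompact_Icc (a := N') (b := N)).image hκ).totallyBounded ε hε
  refine ⟨insert a (insert b t), (ht.insert b).insert a, ?_⟩
  rintro _ ⟨x, rfl⟩
  simp only [mem_iUnion, mem_insert_iff, exists_prop, exists_eq_or_imp]
  rcases le_total N x with h | h
  · exact Or.inl (hN x h)
  rcases le_total x N' with h' | h'
  · exact Or.inr (Or.inl (hN' x h'))
  · exact Or.inr (Or.inr (by simpa using hcov (mem_image_of_mem κ ⟨h', h⟩)))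

/-- The functionals `κ x` form a totally bounded set. Replace `κ x` by an average of finitely many
of them, weighted by a continuous partition of unity that is supported where the error is below `ε`.
This is a uniform finite rank approximation, so no compactness of the real line is needed. -/
theorem familyOp_mem_finiteRankLimits {X : Type*} [NormedAddCommGroup X] [NormedSpace ℂ X]
    (κ : ℝ →ᵇ (X →L[ℂ] ℂ)) {a b : X →L[ℂ] ℂ} (ha : Tendsto κ atTop (𝓝 a))
    (hb : Tendsto κ atBot (𝓝 b)) : familyOp κ ∈ finiteRankLimits X (ℝ →ᵇ ℂ) := by
  refine mem_finiteRankLimits_of_forall_exists fun ε hε => ?_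
  obtain ⟨t, ht, hcov⟩ := Metric.totallyBounded_iff.mp
    (totallyBounded_range_of_tendsto κ.continuous ha hb) ε hε
  obtain ⟨n, L, rfl⟩ : ∃ (n : ℕ) (L : Fin n → X →L[ℂ] ℂ), range L = t := by
    obtain ⟨n, L, hL⟩ := ht.fin_param
    exact ⟨n, L, hL.2⟩
  set χ : Fin n → ℝ → ℝ := fun i x => max 0 (ε - ‖κ x - L i‖) with hχ
  have hχ0 : ∀ i x, 0 ≤ χ i x := fun i x => le_max_left _ _
  have hχc : ∀ i, Continuous (χ i) := fun i => by
    have := κ.continuous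
    fun_prop
  have hpos : ∀ x, 0 < ∑ i, χ i x := by
    intro x
    obtain ⟨i, hi⟩ : ∃ i, κ x ∈ Metric.ball (L i) ε := by
      simpa using hcov (mem_range_self x)
    rw [mem_ball_iff_norm] at hi
    exact Finset.sum_pos' (fun j _ => hχ0 j x)
      ⟨i, Finset.mem_univ i, lt_max_of_lt_right (by linarith)⟩
  have hψle : ∀ i x, χ i x / ∑ j, χ j x ≤ 1 := fun i x =>
    (div_le_one (hpos x)).mpr (Finset.single_le_sum (fun j _ => hχ0 j x) (Finset.mem_univ i))
  set ψ : Fin n → ℝ →ᵇ ℂ := fun i => BoundedContinuousFunction.ofNormedAddCommGroup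
    (fun x => ((χ i x / ∑ j, χ j x : ℝ) : ℂ))
    (Complex.continuous_ofReal.comp ((hχc i).div (continuous_finsetSum _ fun j _ => hχc j)
      fun x => (hpos x).ne')) 1 (fun x => by
        rw [Complex.norm_real, Real.norm_of_nonneg (div_nonneg (hχ0 i x) (hpos x).le)]
        exact hψle i x)
  have hψ : ∀ i x, ψ i x = ((χ i x / ∑ j, χ j x : ℝ) : ℂ) := fun i x => rfl
  refine ⟨Fin n, inferInstance, L, ψ, ContinuousLinearMap.opNorm_le_bound _ hε.le fun f => ?_⟩
  refine (BoundedContinuousFunction.norm_le (by positivity)).mpr fun x => ?_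
  have hsum : ∑ i, ψ i x = 1 := by
    simp only [hψ]
    rw [← Complex.ofReal_sum, ← Finset.sum_div, div_self (hpos x).ne', Complex.ofReal_one]
  have h1 : (familyOp κ - ∑ i, (L i).smulRight (ψ i)) f x = ∑ i, ψ i x * (κ x - L i) f := by
    simp only [sub_apply, mul_sub, Finset.sum_sub_distrib, ← Finset.sum_mul, hsum, one_mul]
    simp [BoundedContinuousFunction.coe_sum, mul_comm]
  have h2 : ∀ i, ‖ψ i x * (κ x - L i) f‖ ≤ (χ i x / ∑ j, χ j x) * (ε * ‖f‖) := by
    intro i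
    rw [norm_mul, hψ, Complex.norm_real,
      Real.norm_of_nonneg (div_nonneg (hχ0 i x) (hpos x).le)]
    rcases le_total ε ‖κ x - L i‖ with h | h
    · have : χ i x = 0 := max_eq_left (by linarith)
      simp [this]
    · exact mul_le_mul_of_nonneg_left ((κ x - L i).le_of_opNorm_le h f)
        (div_nonneg (hχ0 i x) (hpos x).le)
  rw [h1]
  refine (norm_sum_le_of_le _ fun i _ => h2 i).trans ?_
  rw [← Finset.sum_mul, ← Finset.sum_div, div_self (hpos x).ne', one_mul]

theorem integrable_mul_bcf {K : ℝ → ℂ} (hK : Integrable K) (f : ℝ →ᵇ ℂ) :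
    Integrable fun ξ => K ξ * f ξ :=
  hK.mul_bdd f.continuous.aestronglyMeasurable (ae_of_all _ f.norm_coe_le_norm)

/-- The functional `f ↦ ∫ K f`. -/
noncomputable def integralFunctional (K : ℝ → ℂ) (hK : Integrable K) : (ℝ →ᵇ ℂ) →L[ℂ] ℂ :=
  LinearMap.mkContinuous
    { toFun := fun f => ∫ ξ, K ξ * f ξ
      map_add' := fun f g => by
        simp only [BoundedContinuousFunction.add_apply, mul_add]
        exact integral_add (integrable_mul_bcf hK f) (integrable_mul_bcf hK g)
      map_smul' := fun c f => by
        simp only [BoundedContinuousFunction.smul_apply, smul_eq_mul, RingHom.id_apply,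
          ← integral_const_mul]
        congr 1 with ξ
        ring } (∫ ξ, ‖K ξ‖)
    (fun f => by
      refine (norm_integral_le_integral_norm _).trans ?_
      rw [← integral_mul_const]
      refine integral_mono (integrable_mul_bcf hK f).norm (hK.norm.mul_const _) fun ξ => ?_
      rw [norm_mul]
      exact mul_le_mul_of_nonneg_left (f.norm_coe_le_norm ξ) (norm_nonneg _))

theorem integralFunctional_apply {K : ℝ → ℂ} (hK : Integrable K) (f : ℝ →ᵇ ℂ) :
    integralFunctional K hK f = ∫ ξ, K ξ * f ξ := rfl

theorem norm_integralFunctional_le {K : ℝ → ℂ} (hK : Integrable K) :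
    ‖integralFunctional K hK‖ ≤ ∫ ξ, ‖K ξ‖ :=
  LinearMap.mkContinuous_norm_le _ (integral_nonneg fun _ => norm_nonneg _) _

theorem integralFunctional_sub {K K' : ℝ → ℂ} (hK : Integrable K) (hK' : Integrable K') :
    integralFunctional K hK - integralFunctional K' hK' =
      integralFunctional (fun ξ => K ξ - K' ξ) (hK.sub hK') := by
  ext f
  simp only [sub_apply, integralFunctional_apply, sub_mul]
  exact (integral_sub (integrable_mul_bcf hK f) (integrable_mul_bcf hK' f)).symm

/-- A continuous strictly increasing bijection of the line. -/
structure IsPhase (y : ℝ → ℝ) : Prop where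
  continuous : Continuous y
  strictMono : StrictMono y
  tendsto_atTop : Tendsto y atTop atTop
  tendsto_atBot : Tendsto y atBot atBot

/-- A bounded kernel that is continuous except for a jump at the origin. -/
structure IsJumpKernel (G : ℝ → ℂ) : Prop where
  measurable : Measurable G
  bounded : ∃ C, ∀ s, ‖G s‖ ≤ C
  continuousAt : ∀ s ≠ 0, ContinuousAt G s

variable {y : ℝ → ℝ} {w : ℝ → ℂ} {G : ℝ → ℂ}

theorem IsJumpKernel.integrable (hG : IsJumpKernel G) (hy : IsPhase y) (hw : Integrable w)
    (x : ℝ) : Integrable fun ξ => G (y ξ - y x) * w ξ := by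
  obtain ⟨C, hC⟩ := hG.bounded
  refine hw.bdd_mul (c := C) ?_ (ae_of_all _ fun ξ => hC _)
  exact (hG.measurable.comp (hy.continuous.measurable.sub_const _)).aestronglyMeasurable

/-- If the kernels `G (y · - y x)` converge almost everywhere, so do the functionals. -/
theorem tendsto_integralFunctional (hG : IsJumpKernel G) (hy : IsPhase y) (hw : Integrable w)
    {l : Filter ℝ} [l.IsCountablyGenerated] {H : ℝ → ℂ} (hH : Integrable fun ξ => H ξ * w ξ)
    (h : ∀ᵐ ξ : ℝ, Tendsto (fun x => G (y ξ - y x)) l (𝓝 (H ξ))) :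
    Tendsto (fun x => integralFunctional _ (hG.integrable hy hw x)) l
      (𝓝 (integralFunctional _ hH)) := by
  rw [tendsto_iff_norm_sub_tendsto_zero]
  refine squeeze_zero (fun _ => norm_nonneg _) (fun x => ?_) (g := fun x =>
    ∫ ξ, ‖G (y ξ - y x) * w ξ - H ξ * w ξ‖) ?_
  · rw [integralFunctional_sub]
    exact norm_integralFunctional_le _
  · obtain ⟨C, hC⟩ := hG.bounded
    have h0 : (0 : ℝ) = ∫ ξ : ℝ, (0 : ℝ) := by simp
    rw [h0]
    refine tendsto_integral_filter_of_dominated_convergence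
      (fun ξ => C * ‖w ξ‖ + ‖H ξ * w ξ‖) (Eventually.of_forall fun x =>
        ((hG.integrable hy hw x).sub hH).norm.aestronglyMeasurable)
      (Eventually.of_forall fun x => ae_of_all _ fun ξ => ?_)
      ((hw.norm.const_mul C).add hH.norm) (h.mono fun ξ hξ => ?_)
    · rw [norm_norm]
      refine (norm_sub_le _ _).trans (add_le_add_left ?_ _)
      rw [norm_mul]
      exact mul_le_mul_of_nonneg_right (hC _) (norm_nonneg _)
    · rw [← norm_zero (E := ℂ), ← sub_self (H ξ * w ξ)]
      exact ((hξ.mul_const _).sub_const _).norm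

/-- The functionals `f ↦ ∫ G (y ξ - y x) w ξ f ξ dξ`, as a function of `x`. -/
noncomputable def kernelFamily (hG : IsJumpKernel G) (hy : IsPhase y) (hw : Integrable w) :
    ℝ →ᵇ ((ℝ →ᵇ ℂ) →L[ℂ] ℂ) :=
  BoundedContinuousFunction.ofNormedAddCommGroup
    (fun x => integralFunctional _ (hG.integrable hy hw x))
    (continuous_iff_continuousAt.mpr fun x => by
      refine tendsto_integralFunctional hG hy hw (hG.integrable hy hw x) ?_
      have hne : ∀ᵐ ξ : ℝ, ξ ≠ x := by simp [ae_iff]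
      refine hne.mono fun ξ hξ => ?_
      have h1 : y ξ - y x ≠ 0 := sub_ne_zero.mpr (hy.strictMono.injective.ne hξ)
      exact (hG.continuousAt _ h1).tendsto.comp
        ((continuous_const.sub hy.continuous).tendsto x))
    (hG.bounded.choose * ∫ ξ, ‖w ξ‖)
    (fun x => by
      refine (norm_integralFunctional_le _).trans ?_
      rw [← integral_const_mul]
      refine integral_mono (hG.integrable hy hw x).norm (hw.norm.const_mul _) fun ξ => ?_
      rw [norm_mul]
      exact mul_le_mul_of_nonneg_right (hG.bounded.choose_spec _) (norm_nonneg _))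

/-- The operator `f ↦ (x ↦ ∫ G (y ξ - y x) w ξ f ξ dξ)`. -/
noncomputable def kernelOp (hG : IsJumpKernel G) (hy : IsPhase y) (hw : Integrable w) :
    (ℝ →ᵇ ℂ) →L[ℂ] (ℝ →ᵇ ℂ) :=
  familyOp (kernelFamily hG hy hw)

theorem kernelOp_apply (hG : IsJumpKernel G) (hy : IsPhase y) (hw : Integrable w) (f : ℝ →ᵇ ℂ)
    (x : ℝ) : kernelOp hG hy hw f x = ∫ ξ, G (y ξ - y x) * w ξ * f ξ := rfl

/-- As `x → +∞` the argument `y ξ - y x` tends to `-∞`, so the limits of `G` at the two ends are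
interchanged. -/
theorem kernelOp_mem_finiteRankLimits (hG : IsJumpKernel G) (hy : IsPhase y) (hw : Integrable w)
    {a b : ℂ} (ha : Tendsto G atTop (𝓝 a)) (hb : Tendsto G atBot (𝓝 b)) :
    kernelOp hG hy hw ∈ finiteRankLimits (ℝ →ᵇ ℂ) (ℝ →ᵇ ℂ) := by
  refine familyOp_mem_finiteRankLimits _
    (tendsto_integralFunctional hG hy hw (hw.const_mul b) (ae_of_all _ fun ξ => ?_))
    (tendsto_integralFunctional hG hy hw (hw.const_mul a) (ae_of_all _ fun ξ => ?_))
  · refine hb.comp ?_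
    simpa only [sub_eq_add_neg, Function.comp_def] using tendsto_atBot_add_const_left _ (y ξ)
      (tendsto_neg_atTop_atBot.comp hy.tendsto_atTop)
  · refine ha.comp ?_
    simpa only [sub_eq_add_neg, Function.comp_def] using tendsto_atTop_add_const_left _ (y ξ)
      (tendsto_neg_atBot_atTop.comp hy.tendsto_atBot)

/-- The operator norm is at most `sup |G| · ∫ |w|`, so a Taylor estimate uniform in `s` passes
directly to the operators. -/
theorem hasDerivAt_kernelOp {G : ℂ → ℝ → ℂ} (hG : ∀ α, IsJumpKernel (G α)) {H : ℝ → ℂ}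
    (hH : IsJumpKernel H) (hy : IsPhase y) (hw : Integrable w) {α₀ : ℂ} {C : ℝ}
    (h : ∀ᶠ α in 𝓝 α₀, ∀ s, ‖G α s - G α₀ s - (α - α₀) * H s‖ ≤ C * ‖α - α₀‖ ^ 2) :
    HasDerivAt (fun α => kernelOp (hG α) hy hw) (kernelOp hH hy hw) α₀ := by
  refine (hasDerivAt_iff_isLittleO (𝕜 := ℂ) (F := (ℝ →ᵇ ℂ) →L[ℂ] (ℝ →ᵇ ℂ))).mpr ?_
  have h2 : (fun α : ℂ => ‖α - α₀‖ ^ 2) =o[𝓝 α₀] fun α => α - α₀ := by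
    have := (Asymptotics.isLittleO_pow_id (𝕜 := ℂ) (n := 2) one_lt_two).comp_tendsto
      (show Tendsto (fun α => α - α₀) (𝓝 α₀) (𝓝 0) by
        simpa using (continuous_sub_right α₀).tendsto α₀)
    exact (this.norm_left.congr_left fun α => by simp)
  refine Asymptotics.IsBigO.trans_isLittleO
    (Asymptotics.IsBigO.of_bound (C * ∫ ξ, ‖w ξ‖) (h.mono fun α hα => ?_)) h2
  have hC : 0 ≤ C * ‖α - α₀‖ ^ 2 := (norm_nonneg _).trans (hα 0)
  have hI : 0 ≤ ∫ ξ, ‖w ξ‖ := integral_nonneg fun _ => norm_nonneg _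
  rw [Real.norm_of_nonneg (by positivity), mul_right_comm]
  refine ContinuousLinearMap.opNorm_le_bound _ (mul_nonneg hC hI) fun f => ?_
  refine (BoundedContinuousFunction.norm_le (by positivity)).mpr fun x => ?_
  have h3 : (kernelOp (hG α) hy hw - kernelOp (hG α₀) hy hw - (α - α₀) • kernelOp hH hy hw) f x =
      ∫ ξ, (G α (y ξ - y x) - G α₀ (y ξ - y x) - (α - α₀) * H (y ξ - y x)) * w ξ * f ξ := by
    have i1 := integrable_mul_bcf ((hG α).integrable hy hw x) f
    have i2 := integrable_mul_bcf ((hG α₀).integrable hy hw x) f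
    have i3 := (integrable_mul_bcf (hH.integrable hy hw x) f).const_mul (α - α₀)
    have i12 : Integrable fun ξ => G α (y ξ - y x) * w ξ * f ξ - G α₀ (y ξ - y x) * w ξ * f ξ :=
      i1.sub i2
    simp only [sub_apply, smul_apply, BoundedContinuousFunction.sub_apply,
      BoundedContinuousFunction.smul_apply, kernelOp_apply, smul_eq_mul]
    rw [← integral_const_mul, ← integral_sub i1 i2, ← integral_sub i12 i3]
    congr 1 with ξ
    ring
  rw [h3]
  refine (norm_integral_le_of_norm_le ((hw.norm.const_mul (C * ‖α - α₀‖ ^ 2)).mul_const ‖f‖)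
    (ae_of_all _ fun ξ => ?_)).trans ?_
  · rw [norm_mul, norm_mul]
    gcongr
    · exact hα _
    · exact f.norm_coe_le_norm ξ
  · rw [integral_mul_const, integral_const_mul]

end Kernel

/-! ### The truncated exponential kernel: limits at infinity and analyticity in the exponent. -/

section ExpKernel

open scoped BoundedContinuousFunction

/-- The kernel `e^{αs}`, cut off to the half-line on which it is bounded. -/
noncomputable def expKernel (α : ℂ) (s : ℝ) : ℂ :=
  if α.re ≤ 0 then if 0 < s then -Complex.exp (α * s) else 0
  else if s ≤ 0 then Complex.exp (α * s) else 0

/-- The derivative of `expKernel` with respect to `α`. -/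
noncomputable def expKernelDeriv (α : ℂ) (s : ℝ) : ℂ := s * expKernel α s

theorem norm_expKernel_le (α : ℂ) (s : ℝ) : ‖expKernel α s‖ ≤ Real.exp (-(|α.re| * |s|)) := by
  unfold expKernel
  split_ifs with h1 h2 h2
  · rw [norm_neg, Complex.norm_exp, abs_of_nonpos h1, abs_of_pos h2]
    simp
  · simpa using (Real.exp_pos _).le
  · rw [Complex.norm_exp, abs_of_pos (not_le.mp h1), abs_of_nonpos h2]
    simp
  · simpa using (Real.exp_pos _).le

theorem norm_expKernel_le_one (α : ℂ) (s : ℝ) : ‖expKernel α s‖ ≤ 1 :=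
  (norm_expKernel_le α s).trans (Real.exp_le_one_iff.mpr (by
    simpa using mul_nonneg (abs_nonneg α.re) (abs_nonneg s)))

theorem measurable_expKernel (α : ℂ) : Measurable (expKernel α) := by
  unfold expKernel
  split_ifs
  · exact Measurable.ite measurableSet_Ioi (by fun_prop) measurable_const
  · exact Measurable.ite measurableSet_Iic (by fun_prop) measurable_const

theorem continuousAt_expKernel (α : ℂ) {s : ℝ} (hs : s ≠ 0) : ContinuousAt (expKernel α) s := by
  have he : Continuous fun s : ℝ => Complex.exp (α * s) := by fun_prop
  by_cases h1 : α.re ≤ 0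
  · rcases hs.lt_or_gt with h | h
    · refine (continuousAt_const (y := (0 : ℂ))).congr ?_
      filter_upwards [Iio_mem_nhds h] with r hr
      simp [expKernel, h1, not_lt.mpr (mem_Iio.mp hr).le]
    · refine he.neg.continuousAt.congr ?_
      filter_upwards [Ioi_mem_nhds h] with r hr
      simp [expKernel, h1, mem_Ioi.mp hr]
  · rcases hs.lt_or_gt with h | h
    · refine he.continuousAt.congr ?_
      filter_upwards [Iio_mem_nhds h] with r hr
      simp [expKernel, h1, (mem_Iio.mp hr).le]
    · refine (continuousAt_const (y := (0 : ℂ))).congr ?_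
      filter_upwards [Ioi_mem_nhds h] with r hr
      simp [expKernel, h1, mem_Ioi.mp hr]

theorem isJumpKernel_expKernel (α : ℂ) : IsJumpKernel (expKernel α) :=
  ⟨measurable_expKernel α, ⟨1, norm_expKernel_le_one α⟩, fun _ hs => continuousAt_expKernel α hs⟩

theorem sq_mul_exp_neg_le {δ : ℝ} (hδ : 0 < δ) {r : ℝ} (hr : 0 ≤ r) :
    r ^ 2 * Real.exp (-(δ * r)) ≤ 2 / δ ^ 2 := by
  have h := Real.quadratic_le_exp_of_nonneg (mul_nonneg hδ.le hr)
  rw [Real.exp_neg, ← div_eq_mul_inv, div_le_div_iff₀ (Real.exp_pos _) (by positivity)]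
  nlinarith [mul_nonneg hδ.le hr]

theorem isJumpKernel_expKernelDeriv {α : ℂ} (hα : α.re ≠ 0) :
    IsJumpKernel (expKernelDeriv α) := by
  refine ⟨by unfold expKernelDeriv; have := measurable_expKernel α; fun_prop,
    ⟨1 + 2 / |α.re| ^ 2, fun s => ?_⟩, fun s hs => ?_⟩
  · rw [expKernelDeriv, norm_mul, Complex.norm_real, Real.norm_eq_abs]
    have h0 := norm_expKernel_le α s
    have h1 := sq_mul_exp_neg_le (abs_pos.mpr hα) (abs_nonneg s)
    have h2 := norm_expKernel_le_one α s
    have h3 := norm_nonneg (expKernel α s)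
    have h4 : |s| * ‖expKernel α s‖ ≤ ‖expKernel α s‖ + |s| ^ 2 * ‖expKernel α s‖ := by
      nlinarith [sq_nonneg (|s| - 1), abs_nonneg s]
    have h5 : |s| ^ 2 * ‖expKernel α s‖ ≤ |s| ^ 2 * Real.exp (-(|α.re| * |s|)) := by gcongr
    linarith
  · exact (Complex.continuous_ofReal.continuousAt).mul (continuousAt_expKernel α hs)

theorem norm_exp_sub_one_sub_self_le (z : ℂ) :
    ‖Complex.exp z - 1 - z‖ ≤ ‖z‖ ^ 2 * Real.exp ‖z‖ := by
  have h := Complex.norm_exp_sub_sum_le_norm_mul_exp z 2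
  simpa [Finset.sum_range_succ, sub_sub] using h

/-- In the disc of radius `|Re α₀|/2` the sign of `Re α` is constant, so the cut-off does not
change. Half of the exponential decay then absorbs the growth of `e^{(α-α₀)s}`, and the other half
absorbs the factor `s²`. -/
theorem eventually_norm_expKernel_sub_le {α₀ : ℂ} (hα₀ : α₀.re ≠ 0) :
    ∀ᶠ α in 𝓝 α₀, ∀ s : ℝ,
      ‖expKernel α s - expKernel α₀ s - (α - α₀) * expKernelDeriv α₀ s‖ ≤
        2 / (|α₀.re| / 2) ^ 2 * ‖α - α₀‖ ^ 2 := by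
  have hδ : 0 < |α₀.re| / 2 := half_pos (abs_pos.mpr hα₀)
  filter_upwards [Metric.ball_mem_nhds α₀ hδ] with α hα s
  rw [mem_ball_iff_norm] at hα
  have hre : |α.re - α₀.re| < |α₀.re| / 2 := by
    rw [← Complex.sub_re]; exact (Complex.abs_re_le_norm _).trans_lt hα
  have hsign : α.re ≤ 0 ↔ α₀.re ≤ 0 := by
    constructor <;> intro h <;> by_contra! h'
    · rw [abs_of_pos h', abs_lt] at hre
      linarith
    · rw [abs_of_nonpos h, abs_lt] at hre
      linarith
  have hfac : expKernel α s = expKernel α₀ s * Complex.exp ((α - α₀) * s) := by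
    unfold expKernel
    simp only [hsign]
    split_ifs
    · rw [neg_mul, ← Complex.exp_add]; ring_nf
    · simp
    · rw [← Complex.exp_add]; ring_nf
    · simp
  have h1 : expKernel α s - expKernel α₀ s - (α - α₀) * expKernelDeriv α₀ s =
      expKernel α₀ s * (Complex.exp ((α - α₀) * s) - 1 - (α - α₀) * s) := by
    rw [hfac, expKernelDeriv]; ring
  have h2 : ‖(α - α₀) * (s : ℂ)‖ = ‖α - α₀‖ * |s| := by simp
  have h3 := norm_exp_sub_one_sub_self_le ((α - α₀) * s)
  rw [h2] at h3
  rw [h1, norm_mul]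
  calc ‖expKernel α₀ s‖ * ‖Complex.exp ((α - α₀) * s) - 1 - (α - α₀) * s‖
      ≤ Real.exp (-(|α₀.re| * |s|)) * ((‖α - α₀‖ * |s|) ^ 2 * Real.exp (|α₀.re| / 2 * |s|)) := by
        gcongr
        · exact norm_expKernel_le _ _
        · refine h3.trans ?_
          gcongr
    _ = (|s| ^ 2 * Real.exp (-(|α₀.re| / 2 * |s|))) * ‖α - α₀‖ ^ 2 := by
        have : Real.exp (-(|α₀.re| / 2 * |s|)) =
            Real.exp (-(|α₀.re| * |s|)) * Real.exp (|α₀.re| / 2 * |s|) := by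
          rw [← Real.exp_add]; ring_nf
        rw [this]; ring
    _ ≤ _ := by
        gcongr
        exact sq_mul_exp_neg_le hδ (abs_nonneg s)

theorem tendsto_expKernel_of_re_ne_zero {α : ℂ} (hα : α.re ≠ 0) {l : Filter ℝ}
    (hl : Tendsto (fun s : ℝ => |s|) l atTop) : Tendsto (expKernel α) l (𝓝 0) := by
  refine squeeze_zero_norm (norm_expKernel_le α) ?_
  exact Real.tendsto_exp_neg_atTop_nhds_zero.comp (hl.const_mul_atTop (abs_pos.mpr hα))

/-- A nonzero imaginary `α` is excluded, as the kernel would oscillate at one end. The case `α = 0`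
comes from the entry `j = c` of column `c`. -/
theorem exists_tendsto_expKernel {α : ℂ} (hα : α.re ≠ 0 ∨ α = 0) :
    ∃ a b, Tendsto (expKernel α) atTop (𝓝 a) ∧ Tendsto (expKernel α) atBot (𝓝 b) := by
  rcases hα with h | rfl
  · exact ⟨0, 0, tendsto_expKernel_of_re_ne_zero h tendsto_abs_atTop_atTop,
      tendsto_expKernel_of_re_ne_zero h tendsto_abs_atBot_atTop⟩
  · refine ⟨-1, 0, tendsto_const_nhds.congr' ?_, tendsto_const_nhds.congr' ?_⟩
    · filter_upwards [Ioi_mem_atTop (0 : ℝ)] with s hs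
      simp [expKernel, mem_Ioi.mp hs]
    · filter_upwards [Iio_mem_atBot (0 : ℝ)] with s hs
      simp [expKernel, not_lt.mpr (mem_Iio.mp hs).le]

/-- The operator with kernel `expKernel α (y ξ - y x) * w ξ`. -/
noncomputable def expOp {y : ℝ → ℝ} {w : ℝ → ℂ} (hy : IsPhase y) (hw : Integrable w) (α : ℂ) :
    (ℝ →ᵇ ℂ) →L[ℂ] (ℝ →ᵇ ℂ) :=
  kernelOp (isJumpKernel_expKernel α) hy hw

variable {y : ℝ → ℝ} {w : ℝ → ℂ} (hy : IsPhase y) (hw : Integrable w)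

theorem analyticAt_expOp {α : ℂ} (hα : α.re ≠ 0) : AnalyticAt ℂ (expOp hy hw) α := by
  have hopen : IsOpen {α : ℂ | α.re ≠ 0} := isOpen_ne_fun Complex.continuous_re continuous_const
  refine DifferentiableOn.analyticAt (E := (ℝ →ᵇ ℂ) →L[ℂ] (ℝ →ᵇ ℂ)) (fun β hβ => ?_)
    (hopen.mem_nhds hα)
  exact (HasDerivAt.differentiableAt (𝕜 := ℂ) (F := (ℝ →ᵇ ℂ) →L[ℂ] (ℝ →ᵇ ℂ))
    (hasDerivAt_kernelOp isJumpKernel_expKernel (isJumpKernel_expKernelDeriv hβ) hy hw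
      (eventually_norm_expKernel_sub_le hβ))).differentiableWithinAt

theorem expOp_mem_finiteRankLimits {α : ℂ} (hα : α.re ≠ 0 ∨ α = 0) :
    expOp hy hw α ∈ finiteRankLimits (ℝ →ᵇ ℂ) (ℝ →ᵇ ℂ) := by
  obtain ⟨a, b, ha, hb⟩ := exists_tendsto_expKernel hα
  exact kernelOp_mem_finiteRankLimits _ hy hw ha hb

end ExpKernel

/-! ### The differential equation satisfied by the integral operators -/

section Oscillation

theorem hasDerivAt_integral_Iic {g : ℝ → ℂ} (hg : Continuous g)
    (hi : ∀ b, IntegrableOn g (Iic b)) (x : ℝ) :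
    HasDerivAt (fun x => ∫ ξ in Iic x, g ξ) (g x) x := by
  have h : (fun x => ∫ ξ in Iic x, g ξ) = fun x => (∫ ξ in Iic 0, g ξ) + ∫ ξ in (0 : ℝ)..x, g ξ := by
    funext b
    rw [← intervalIntegral.integral_Iic_sub_Iic (hi 0) (hi b)]
    ring
  rw [h]
  exact (hg.integral_hasStrictDerivAt 0 x).hasDerivAt.const_add _

theorem hasDerivAt_integral_Ioi {g : ℝ → ℂ} (hg : Continuous g)
    (hi : ∀ b, IntegrableOn g (Ioi b)) (x : ℝ) :
    HasDerivAt (fun x => ∫ ξ in Ioi x, g ξ) (-g x) x := by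
  have h : (fun x => ∫ ξ in Ioi x, g ξ) = fun x => (∫ ξ in Ioi 0, g ξ) - ∫ ξ in (0 : ℝ)..x, g ξ := by
    funext b
    rw [← intervalIntegral.integral_interval_add_Ioi (hi 0) (hi b)]
    ring
  rw [h]
  exact (hg.integral_hasStrictDerivAt 0 x).hasDerivAt.const_sub _

theorem integral_expKernel_of_nonpos {y : ℝ → ℝ} (hy : StrictMono y) {α : ℂ} (hα : α.re ≤ 0)
    (V : ℝ → ℂ) (x : ℝ) : ∫ ξ, expKernel α (y ξ - y x) * V ξ =
      -∫ ξ in Ioi x, Complex.exp (α * (y ξ - y x : ℝ)) * V ξ := by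
  rw [← integral_neg, ← integral_indicator measurableSet_Ioi]
  congr 1 with ξ
  by_cases h : x < ξ
  · rw [indicator_of_mem (mem_Ioi.mpr h), expKernel, if_pos hα, if_pos (sub_pos.mpr (hy h))]
    ring
  · rw [indicator_of_notMem (by simpa using h), expKernel, if_pos hα,
      if_neg (by rw [sub_pos, hy.lt_iff_lt]; exact h), zero_mul]

theorem integral_expKernel_of_pos {y : ℝ → ℝ} (hy : StrictMono y) {α : ℂ} (hα : ¬ α.re ≤ 0)
    (V : ℝ → ℂ) (x : ℝ) : ∫ ξ, expKernel α (y ξ - y x) * V ξ =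
      ∫ ξ in Iic x, Complex.exp (α * (y ξ - y x : ℝ)) * V ξ := by
  rw [← integral_indicator measurableSet_Iic]
  congr 1 with ξ
  by_cases h : ξ ≤ x
  · rw [indicator_of_mem (mem_Iic.mpr h), expKernel, if_neg hα,
      if_pos (sub_nonpos.mpr (hy.monotone h))]
  · rw [indicator_of_notMem (by simpa using h), expKernel, if_neg hα,
      if_neg (by rw [sub_nonpos, hy.le_iff_le]; exact h), zero_mul]

variable {y Q : ℝ → ℝ} (hy : StrictMono y) (hd : ∀ x, HasDerivAt y (Q x) x) (hQ : Continuous Q)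

theorem hasDerivAt_exp_phase (hd : ∀ x, HasDerivAt y (Q x) x) (α : ℂ) (c x : ℝ) :
    HasDerivAt (fun ξ => Complex.exp (α * (y ξ - c : ℝ)))
      (Complex.exp (α * (y x - c : ℝ)) * (α * Q x)) x :=
  ((((hd x).sub_const c).ofReal_comp).const_mul α).cexp

include hy hd in
theorem hasDerivAt_integral_expKernel (α : ℂ) {V : ℝ → ℂ} (hV : Continuous V)
    (hVi : Integrable V) (x : ℝ) :
    HasDerivAt (fun x => ∫ ξ, expKernel α (y ξ - y x) * V ξ)
      (-(α * Q x) * (∫ ξ, expKernel α (y ξ - y x) * V ξ) + V x) x := by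
  have hyc : Continuous y := continuous_iff_continuousAt.mpr fun x => (hd x).continuousAt
  set g : ℝ → ℂ := fun ξ => Complex.exp (α * (y ξ - 0 : ℝ)) * V ξ with hgdef
  have hg : Continuous g := by fun_prop
  have hsplit : ∀ x ξ : ℝ, Complex.exp (α * (y ξ - y x : ℝ)) * V ξ =
      Complex.exp (-α * (y x - 0 : ℝ)) * g ξ := by
    intro x ξ
    simp only [hgdef]
    rw [← mul_assoc, ← Complex.exp_add]
    congr 2
    push_cast
    ring
  have hgb : ∀ ξ, ‖g ξ‖ = Real.exp (α.re * y ξ) * ‖V ξ‖ := by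
    intro ξ
    simp [hgdef, Complex.norm_exp]
  have hE := hasDerivAt_exp_phase hd (-α) 0 x
  have hcancel : Complex.exp (-α * (y x - 0 : ℝ)) * g x = V x := by
    rw [← hsplit]; simp
  by_cases hα : α.re ≤ 0
  · have hi : ∀ b, IntegrableOn g (Ioi b) := fun b => by
      refine Integrable.mono' ((hVi.norm.const_mul (Real.exp (α.re * y b))).integrableOn)
        hg.aestronglyMeasurable ((ae_restrict_iff' measurableSet_Ioi).mpr (ae_of_all _ ?_))
      intro ξ hξ
      rw [hgb]
      exact mul_le_mul_of_nonneg_right (Real.exp_le_exp.mpr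
        (mul_le_mul_of_nonpos_left (hy (mem_Ioi.mp hξ)).le hα)) (norm_nonneg _)
    simp only [integral_expKernel_of_nonpos hy hα, hsplit, integral_const_mul]
    refine (hE.mul (hasDerivAt_integral_Ioi hg hi x)).neg.congr_deriv ?_
    rw [← hcancel]
    ring
  · have hi : ∀ b, IntegrableOn g (Iic b) := fun b => by
      refine Integrable.mono' ((hVi.norm.const_mul (Real.exp (α.re * y b))).integrableOn)
        hg.aestronglyMeasurable ((ae_restrict_iff' measurableSet_Iic).mpr (ae_of_all _ ?_))
      intro ξ hξ
      rw [hgb]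
      exact mul_le_mul_of_nonneg_right (Real.exp_le_exp.mpr
        (mul_le_mul_of_nonneg_left (hy.monotone (mem_Iic.mp hξ)) (not_le.mp hα).le)) (norm_nonneg _)
    simp only [integral_expKernel_of_pos hy hα, hsplit, integral_const_mul]
    refine (hE.mul (hasDerivAt_integral_Iic hg hi x)).congr_deriv ?_
    rw [← hcancel]
    ring

-- The integrand is the `ξ`-derivative of `e^{α(y ξ - y x)} F ξ`. The boundary term at `ξ = x`
-- survives with the same sign for either cut-off, and the far one vanishes by compact support.
include hy hd hQ in
theorem integral_expKernel_of_hasCompactSupport (α : ℂ) {F F' : ℝ → ℂ} (hF : HasCompactSupport F)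
    (hFd : ∀ x, HasDerivAt F (F' x) x) (hF' : Continuous F') (x : ℝ) :
    ∫ ξ, expKernel α (y ξ - y x) * (F' ξ + α * Q ξ * F ξ) = F x := by
  have hyc : Continuous y := continuous_iff_continuousAt.mpr fun x => (hd x).continuousAt
  set u : ℝ → ℂ := fun ξ => Complex.exp (α * (y ξ - y x : ℝ)) * F ξ with hu
  have hud : ∀ ξ, HasDerivAt u
      (Complex.exp (α * (y ξ - y x : ℝ)) * (F' ξ + α * Q ξ * F ξ)) ξ := fun ξ =>
    ((hasDerivAt_exp_phase hd α (y x) ξ).mul (hFd ξ)).congr_deriv (by ring)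
  have hFc : Continuous F := continuous_iff_continuousAt.mpr fun x => (hFd x).continuousAt
  have hu1 : ContDiff ℝ 1 u := by
    rw [contDiff_one_iff_deriv]
    refine ⟨fun ξ => (hud ξ).differentiableAt, ?_⟩
    rw [show deriv u = _ from funext fun ξ => (hud ξ).deriv]
    fun_prop
  have huc : HasCompactSupport u := hF.mul_left
  have hux : u x = F x := by simp [hu]
  by_cases hα : α.re ≤ 0
  · rw [integral_expKernel_of_nonpos hy hα, ← hux, neg_eq_iff_eq_neg,
      ← huc.integral_Ioi_deriv_eq hu1 x]
    exact integral_congr_ae (ae_of_all _ fun ξ => (hud ξ).deriv.symm)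
  · rw [integral_expKernel_of_pos hy hα, ← hux, ← huc.integral_Iic_deriv_eq hu1 x]
    exact integral_congr_ae (ae_of_all _ fun ξ => (hud ξ).deriv.symm)

include hy hd hQ in
/-- Integration by parts against an oscillating or decaying exponential. -/
theorem norm_mul_integral_expKernel_le (α β : ℂ) {φ φ' f g : ℝ → ℂ} (hφ : HasCompactSupport φ)
    (hφd : ∀ x, HasDerivAt φ (φ' x) x) (hφ' : Continuous φ')
    (hf : ∀ x, HasDerivAt f (β * Q x * f x + g x) x) (hg : Continuous g) (x : ℝ) :
    ‖(α + β) * ∫ ξ, expKernel α (y ξ - y x) * (Q ξ * φ ξ * f ξ)‖ ≤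
      ‖φ x‖ * ‖f x‖ + ∫ ξ, ‖φ' ξ * f ξ + φ ξ * g ξ‖ := by
  have hyc : Continuous y := continuous_iff_continuousAt.mpr fun x => (hd x).continuousAt
  have hφc : Continuous φ := continuous_iff_continuousAt.mpr fun x => (hφd x).continuousAt
  have hfc : Continuous f := continuous_iff_continuousAt.mpr fun x => (hf x).continuousAt
  have hφ's : HasCompactSupport φ' := by
    rw [← show deriv φ = φ' from funext fun ξ => (hφd ξ).deriv]
    exact hφ.deriv
  have hFd : ∀ ξ, HasDerivAt (fun ξ => φ ξ * f ξ)
      (φ' ξ * f ξ + φ ξ * (β * Q ξ * f ξ + g ξ)) ξ := fun ξ => (hφd ξ).mul (hf ξ)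
  have hQc : Continuous fun ξ => (Q ξ : ℂ) := Complex.continuous_ofReal.comp hQ
  have key := integral_expKernel_of_hasCompactSupport hy hd hQ α (hφ.mul_right (f' := f)) hFd
    (by fun_prop) x
  simp only [Pi.mul_apply] at key
  have hG : Measurable fun ξ => expKernel α (y ξ - y x) :=
    (measurable_expKernel α).comp (hyc.measurable.sub_const _)
  have hmul : ∀ V : ℝ → ℂ, Integrable V →
      Integrable fun ξ => expKernel α (y ξ - y x) * V ξ := fun V hV =>
    hV.bdd_mul (c := 1) hG.aestronglyMeasurable (ae_of_all _ fun ξ => norm_expKernel_le_one _ _)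
  have i1 : Integrable fun ξ => (Q ξ : ℂ) * φ ξ * f ξ :=
    Continuous.integrable_of_hasCompactSupport (by fun_prop) ((hφ.mul_left).mul_right)
  have i2 : Integrable fun ξ => φ' ξ * f ξ + φ ξ * g ξ :=
    Continuous.integrable_of_hasCompactSupport (by fun_prop)
      ((hφ's.mul_right (f' := f)).add (hφ.mul_right (f' := g)))
  -- With `F = φ f`, the expression `F' + αQF` equals `(α + β) Q φ f + (φ' f + φ g)`: the exponents
  -- of the kernel and of `f` add up.
  have h1 : (α + β) * ∫ ξ, expKernel α (y ξ - y x) * (Q ξ * φ ξ * f ξ) =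
      φ x * f x - ∫ ξ, expKernel α (y ξ - y x) * (φ' ξ * f ξ + φ ξ * g ξ) := by
    rw [← key, ← integral_const_mul, eq_sub_iff_add_eq, ← integral_add ((hmul _ i1).const_mul _)
      (hmul _ i2)]
    congr 1 with ξ
    ring
  rw [h1, ← norm_mul]
  refine (norm_sub_le _ _).trans (add_le_add_right ?_ _)
  refine norm_integral_le_of_norm_le i2.norm (ae_of_all _ fun ξ => ?_)
  rw [norm_mul]
  exact mul_le_of_le_one_left (norm_nonneg _) (norm_expKernel_le_one _ _)

end Oscillation

/-! ### The integral system for one column -/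

section Column

open scoped BoundedContinuousFunction

/-- A phase `y` with `y' = Q` bounded above and below, and two integrable coefficients. -/
structure IsScattering (y Q : ℝ → ℝ) (p r : ℝ → ℂ) : Prop where
  hasDerivAt : ∀ x, HasDerivAt y (Q x) x
  continuous_speed : Continuous Q
  lower : ∃ c, 0 < c ∧ ∀ x, c ≤ Q x
  upper : ∃ C, ∀ x, Q x ≤ C
  continuous_fst : Continuous p
  integrable_fst : Integrable p
  continuous_snd : Continuous r
  integrable_snd : Integrable r

variable {y Q : ℝ → ℝ} {p r : ℝ → ℂ}

theorem IsScattering.isPhase (h : IsScattering y Q p r) : IsPhase y := by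
  obtain ⟨c, hc, hQ⟩ := h.lower
  have hyc : Continuous y := continuous_iff_continuousAt.mpr fun x => (h.hasDerivAt x).continuousAt
  have hdiff : ∀ a b, a ≤ b → c * (b - a) ≤ y b - y a := fun a b hab =>
    mul_sub_le_image_sub_of_le_deriv (fun x => (h.hasDerivAt x).differentiableAt)
      (fun x => by rw [(h.hasDerivAt x).deriv]; exact hQ x) hab
  refine ⟨hyc, fun a b hab => ?_, ?_, ?_⟩
  · nlinarith [hdiff a b hab.le, mul_pos hc (sub_pos.mpr hab)]
  · refine tendsto_atTop_mono' _ ?_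
      (tendsto_atTop_add_const_left atTop (y 0) (tendsto_id.const_mul_atTop hc))
    filter_upwards [eventually_ge_atTop 0] with x hx
    have := hdiff 0 x hx
    simp only [id]
    linarith
  · refine tendsto_atBot_mono' _ ?_
      (tendsto_atBot_add_const_left atBot (y 0) (tendsto_id.const_mul_atBot hc))
    filter_upwards [eventually_le_atBot 0] with x hx
    have := hdiff x 0 hx
    simp only [id]
    linarith

/-- The integral operator of the `c`-th column of the system. -/
noncomputable def columnOp (h : IsScattering y Q p r) (c : Fin 3) (Λ : Fin 3 → ℂ)
    (A B : Fin 3 → Fin 3 → ℂ) : (Fin 3 → (ℝ →ᵇ ℂ)) →L[ℂ] (Fin 3 → (ℝ →ᵇ ℂ)) :=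
  ∑ j, ∑ l, (ContinuousLinearMap.single ℂ (fun _ : Fin 3 => ℝ →ᵇ ℂ) j).comp
    ((A j l • expOp h.isPhase h.integrable_fst (Λ c - Λ j) +
      B j l • expOp h.isPhase h.integrable_snd (Λ c - Λ j)).comp (ContinuousLinearMap.proj l))

theorem columnOp_mem_finiteRankLimits (h : IsScattering y Q p r) (c : Fin 3) {Λ : Fin 3 → ℂ}
    (A B : Fin 3 → Fin 3 → ℂ) (hΛ : ∀ j, j ≠ c → (Λ c).re ≠ (Λ j).re) :
    columnOp h c Λ A B ∈ finiteRankLimits (Fin 3 → (ℝ →ᵇ ℂ)) (Fin 3 → (ℝ →ᵇ ℂ)) := by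
  refine Submodule.sum_mem _ fun j _ => Submodule.sum_mem _ fun l _ =>
    comp_mem_finiteRankLimits (mem_finiteRankLimits_comp ?_ _) _
  have hα : (Λ c - Λ j).re ≠ 0 ∨ Λ c - Λ j = 0 := by
    rcases eq_or_ne j c with rfl | hj
    · simp
    · exact Or.inl (by rw [Complex.sub_re]; exact sub_ne_zero.mpr (hΛ j hj))
  exact Submodule.add_mem _ (Submodule.smul_mem _ _ (expOp_mem_finiteRankLimits _ _ hα))
    (Submodule.smul_mem _ _ (expOp_mem_finiteRankLimits _ _ hα))

theorem analyticAt_columnOp (h : IsScattering y Q p r) (c : Fin 3) {Λ : ℂ → Fin 3 → ℂ}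
    {A B : ℂ → Fin 3 → Fin 3 → ℂ} {k : ℂ} (hΛ : ∀ j, j ≠ c → (Λ k c).re ≠ (Λ k j).re)
    (hΛd : ∀ j, AnalyticAt ℂ (fun k => Λ k j) k)
    (hA : ∀ j l, AnalyticAt ℂ (fun k => A k j l) k)
    (hB : ∀ j l, AnalyticAt ℂ (fun k => B k j l) k) :
    AnalyticAt ℂ (fun k => columnOp h c (Λ k) (A k) (B k)) k := by
  have hexp : ∀ {w : ℝ → ℂ} (hw : Integrable w) (j : Fin 3),
      AnalyticAt ℂ (fun k => expOp h.isPhase hw (Λ k c - Λ k j)) k := by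
    intro w hw j
    rcases eq_or_ne j c with rfl | hj
    · simp only [sub_self]
      exact analyticAt_const
    · have : (Λ k c - Λ k j).re ≠ 0 := by
        rw [Complex.sub_re]; exact sub_ne_zero.mpr (hΛ j hj)
      exact AnalyticAt.fun_comp_of_eq (analyticAt_expOp h.isPhase hw this)
        ((hΛd c).sub (hΛd j)) rfl
  refine Finset.analyticAt_fun_sum _ fun j _ => Finset.analyticAt_fun_sum _ fun l _ => ?_
  have hadd := ((hA j l).smul (hexp h.integrable_fst j)).add
    ((hB j l).smul (hexp h.integrable_snd j))
  -- Placing an operator in the matrix entry `(j, l)` is continuous and linear in the operator, so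
  -- it preserves analyticity.
  have hlin := AnalyticAt.fun_comp_of_eq
    ((((ContinuousLinearMap.compL ℂ (Fin 3 → (ℝ →ᵇ ℂ)) (ℝ →ᵇ ℂ) (Fin 3 → (ℝ →ᵇ ℂ)))
      (ContinuousLinearMap.single ℂ (fun _ : Fin 3 => ℝ →ᵇ ℂ) j)).comp
      ((ContinuousLinearMap.compL ℂ (Fin 3 → (ℝ →ᵇ ℂ)) (ℝ →ᵇ ℂ) (ℝ →ᵇ ℂ)).flip
        (ContinuousLinearMap.proj l))).analyticAt _) hadd rfl
  exact hlin

/-- The integrand of the system, without the exponentials. -/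
def potentialMul (p r : ℝ → ℂ) (A B : Fin 3 → Fin 3 → ℂ) (f : Fin 3 → ℝ → ℂ) (j : Fin 3)
    (ξ : ℝ) : ℂ :=
  ∑ l, (A j l * p ξ + B j l * r ξ) * f l ξ

theorem integrable_expKernel_mul (hy : IsPhase y) (α : ℂ) (x : ℝ) {V : ℝ → ℂ}
    (hV : Integrable V) : Integrable fun ξ => expKernel α (y ξ - y x) * V ξ :=
  (isJumpKernel_expKernel α).integrable hy hV x

theorem columnOp_apply_eq_sum (h : IsScattering y Q p r) (c : Fin 3) (Λ : Fin 3 → ℂ)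
    (A B : Fin 3 → Fin 3 → ℂ) (f : Fin 3 → (ℝ →ᵇ ℂ)) (j : Fin 3) (x : ℝ) :
    columnOp h c Λ A B f j x = ∑ l,
      (A j l * (∫ ξ, expKernel (Λ c - Λ j) (y ξ - y x) * (p ξ * f l ξ)) +
        B j l * ∫ ξ, expKernel (Λ c - Λ j) (y ξ - y x) * (r ξ * f l ξ)) := by
  simp only [← mul_assoc (expKernel _ _)]
  simp only [columnOp, sum_apply, Finset.sum_apply,
    ContinuousLinearMap.comp_apply, ContinuousLinearMap.single_apply]
  rw [Finset.sum_eq_single j (fun i _ hi => by simp [Pi.single_eq_of_ne hi.symm])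
    (fun hj => absurd (Finset.mem_univ j) hj)]
  simp only [Pi.single_eq_same, BoundedContinuousFunction.coe_sum, Finset.sum_apply]
  rfl

theorem columnOp_apply (h : IsScattering y Q p r) (c : Fin 3) (Λ : Fin 3 → ℂ)
    (A B : Fin 3 → Fin 3 → ℂ) (f : Fin 3 → (ℝ →ᵇ ℂ)) (j : Fin 3) (x : ℝ) :
    columnOp h c Λ A B f j x = ∫ ξ, expKernel (Λ c - Λ j) (y ξ - y x) *
      potentialMul p r A B (fun l => f l) j ξ := by
  have ip : ∀ l, Integrable fun ξ => expKernel (Λ c - Λ j) (y ξ - y x) * (p ξ * f l ξ) := fun l =>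
    integrable_expKernel_mul h.isPhase _ x (integrable_mul_bcf h.integrable_fst (f l))
  have ir : ∀ l, Integrable fun ξ => expKernel (Λ c - Λ j) (y ξ - y x) * (r ξ * f l ξ) := fun l =>
    integrable_expKernel_mul h.isPhase _ x (integrable_mul_bcf h.integrable_snd (f l))
  have is : ∀ l, Integrable fun ξ => A j l * (expKernel (Λ c - Λ j) (y ξ - y x) * (p ξ * f l ξ)) +
      B j l * (expKernel (Λ c - Λ j) (y ξ - y x) * (r ξ * f l ξ)) := fun l =>
    ((ip l).const_mul (A j l)).add ((ir l).const_mul (B j l))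
  rw [columnOp_apply_eq_sum]
  simp only [← integral_const_mul]
  rw [Finset.sum_congr rfl fun l _ =>
    (integral_add ((ip l).const_mul (A j l)) ((ir l).const_mul (B j l))).symm]
  rw [← integral_finsetSum _ fun l _ => is l]
  congr 1 with ξ
  rw [potentialMul, Finset.mul_sum]
  exact Finset.sum_congr rfl fun l _ => by ring

theorem continuous_potentialMul (h : IsScattering y Q p r) (A B : Fin 3 → Fin 3 → ℂ)
    (f : Fin 3 → (ℝ →ᵇ ℂ)) (j : Fin 3) : Continuous (potentialMul p r A B (fun l => f l) j) := by
  have h1 := h.continuous_fst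
  have h2 := h.continuous_snd
  unfold potentialMul
  fun_prop

theorem integrable_potentialMul (h : IsScattering y Q p r) (A B : Fin 3 → Fin 3 → ℂ)
    (f : Fin 3 → (ℝ →ᵇ ℂ)) (j : Fin 3) : Integrable (potentialMul p r A B (fun l => f l) j) :=
  integrable_finsetSum _ fun l _ => integrable_mul_bcf
    ((h.integrable_fst.const_mul (A j l)).add (h.integrable_snd.const_mul (B j l))) (f l)

/-- The constant term sits in row `c` alone, where the exponent `Λ c - Λ c` vanishes, so it leaves
no trace in the differential equation. -/
theorem hasDerivAt_of_eq_columnOp (h : IsScattering y Q p r) (c : Fin 3) (Λ : Fin 3 → ℂ)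
    (A B : Fin 3 → Fin 3 → ℂ) {f : Fin 3 → (ℝ →ᵇ ℂ)} {a : ℂ}
    (hf : f = Pi.single c (BoundedContinuousFunction.const ℝ a) + columnOp h c Λ A B f)
    (l : Fin 3) (x : ℝ) :
    HasDerivAt (f l) (-(Λ c - Λ l) * Q x * f l x + potentialMul p r A B (fun l => f l) l x) x := by
  have h1 : ∀ x, f l x = Pi.single (M := fun _ => ℂ) c a l +
      ∫ ξ, expKernel (Λ c - Λ l) (y ξ - y x) * potentialMul p r A B (fun l => f l) l ξ := by
    intro x
    rw [← columnOp_apply h]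
    conv_lhs => rw [hf]
    rw [Pi.add_apply, BoundedContinuousFunction.add_apply]
    congr 1
    rcases eq_or_ne l c with rfl | hl
    · simp
    · simp [hl]
  have h2 := (hasDerivAt_integral_expKernel h.isPhase.strictMono h.hasDerivAt (Λ c - Λ l)
    (continuous_potentialMul h A B f l) (integrable_potentialMul h A B f l) x).const_add
    (Pi.single (M := fun _ => ℂ) c a l)
  rw [show ⇑(f l) = _ from funext h1]
  refine h2.congr_deriv ?_
  rcases eq_or_ne l c with rfl | hl
  · simp
  · simp only [Pi.single_eq_of_ne hl, zero_add]
    ring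

/-- Integration by parts requires a differentiable weight, but `p` is merely continuous and
integrable. Approximating `p / Q` instead of `p` leaves the factor `Q` that the integration by parts
consumes. -/
theorem exists_smooth_approx (h : IsScattering y Q p r) {ε : ℝ} (hε : 0 < ε) :
    ∃ φ : ℝ → ℂ, HasCompactSupport φ ∧ ContDiff ℝ 1 φ ∧ ∫ ξ, ‖p ξ - Q ξ * φ ξ‖ ≤ ε := by
  obtain ⟨c, hc, hQc⟩ := h.lower
  obtain ⟨C, hQC⟩ := h.upper
  have hQpos : ∀ x, 0 < Q x := fun x => hc.trans_le (hQc x)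
  have hC : 0 < C := (hQpos 0).trans_le (hQC 0)
  have hQ' : Continuous fun x => (Q x : ℂ) := Complex.continuous_ofReal.comp h.continuous_speed
  have hi : Integrable fun x => (Q x : ℂ)⁻¹ * p x := by
    refine h.integrable_fst.bdd_mul (c := c⁻¹)
      (hQ'.inv₀ fun x => Complex.ofReal_ne_zero.mpr (hQpos x).ne').aestronglyMeasurable
      (ae_of_all _ fun x => ?_)
    rw [norm_inv, Complex.norm_real, Real.norm_of_nonneg (hQpos x).le]
    exact inv_anti₀ hc (hQc x)
  obtain ⟨φ, hφ, hφs, hle⟩ := (memLp_one_iff_integrable.mpr hi).exist_eLpNorm_sub_le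
    ENNReal.one_ne_top le_rfl (div_pos hε hC)
  have hφi : Integrable φ := hφs.continuous.integrable_of_hasCompactSupport hφ
  refine ⟨φ, hφ, hφs.of_le (by exact_mod_cast le_top), ?_⟩
  have h1 : ∫ ξ, ‖(Q ξ : ℂ)⁻¹ * p ξ - φ ξ‖ ≤ ε / C := by
    rw [eLpNorm_one_eq_lintegral_enorm, ← ofReal_integral_norm_eq_lintegral_enorm (hi.sub hφi),
      ENNReal.ofReal_le_ofReal_iff (by positivity)] at hle
    exact hle
  calc ∫ ξ, ‖p ξ - Q ξ * φ ξ‖ ≤ ∫ ξ, C * ‖(Q ξ : ℂ)⁻¹ * p ξ - φ ξ‖ := by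
        refine integral_mono_of_nonneg (ae_of_all _ fun _ => norm_nonneg _)
          ((hi.sub hφi).norm.const_mul C) (ae_of_all _ fun ξ => ?_)
        have : p ξ - Q ξ * φ ξ = Q ξ * ((Q ξ : ℂ)⁻¹ * p ξ - φ ξ) := by
          have := Complex.ofReal_ne_zero.mpr (hQpos ξ).ne'
          field_simp
        beta_reduce
        rw [this, norm_mul, Complex.norm_real, Real.norm_of_nonneg (hQpos ξ).le]
        exact mul_le_mul_of_nonneg_right (hQC ξ) (norm_nonneg _)
    _ = C * ∫ ξ, ‖(Q ξ : ℂ)⁻¹ * p ξ - φ ξ‖ := integral_const_mul _ _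
    _ ≤ C * (ε / C) := by gcongr
    _ = ε := by field_simp

end Column

/-! ### Smallness of the column operator along solutions, for widely separated exponents. -/

section LargeParameter

open scoped BoundedContinuousFunction

variable {y Q : ℝ → ℝ} {p r : ℝ → ℂ}

theorem norm_integral_expKernel_mul_le (α : ℂ) (y : ℝ → ℝ) (x : ℝ) {w : ℝ → ℂ} (hw : Integrable w)
    (f : Fin 3 → (ℝ →ᵇ ℂ)) (l : Fin 3) :
    ‖∫ ξ, expKernel α (y ξ - y x) * (w ξ * f l ξ)‖ ≤ (∫ ξ, ‖w ξ‖) * ‖f‖ := by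
  rw [← integral_mul_const]
  refine norm_integral_le_of_norm_le (hw.norm.mul_const _) (ae_of_all _ fun ξ => ?_)
  rw [norm_mul, norm_mul]
  refine (mul_le_of_le_one_left (by positivity) (norm_expKernel_le_one _ _)).trans ?_
  gcongr
  exact ((f l).norm_coe_le_norm ξ).trans (norm_le_pi_norm f l)

theorem norm_potentialMul_le {A B : Fin 3 → Fin 3 → ℂ} {C₀ : ℝ} (hA : ∀ j l, ‖A j l‖ ≤ C₀)
    (hB : ∀ j l, ‖B j l‖ ≤ 1) (f : Fin 3 → (ℝ →ᵇ ℂ)) (j : Fin 3) (ξ : ℝ) :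
    ‖potentialMul p r A B (fun l => f l) j ξ‖ ≤ 3 * (C₀ * ‖p ξ‖ + ‖r ξ‖) * ‖f‖ := by
  have h1 : ∀ l, ‖(A j l * p ξ + B j l * r ξ) * f l ξ‖ ≤ (C₀ * ‖p ξ‖ + ‖r ξ‖) * ‖f‖ := by
    intro l
    rw [norm_mul]
    have h2 : ‖A j l * p ξ + B j l * r ξ‖ ≤ C₀ * ‖p ξ‖ + ‖r ξ‖ := by
      refine (norm_add_le _ _).trans (add_le_add ?_ ?_)
      · rw [norm_mul]; gcongr; exact hA j l
      · rw [norm_mul]; exact mul_le_of_le_one_left (norm_nonneg _) (hB j l)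
    exact mul_le_mul h2 (((f l).norm_coe_le_norm ξ).trans (norm_le_pi_norm f l)) (norm_nonneg _)
      ((norm_nonneg _).trans h2)
  refine (norm_sum_le_of_le _ fun l _ => h1 l).trans_eq ?_
  simp
  ring

/-- For a system whose diagonal and second coefficients are small and whose exponents are far
apart, the integral operator is small along solutions. -/
theorem exists_norm_columnOp_le (h : IsScattering y Q p r) {C₀ ε : ℝ} (hC₀ : 0 < C₀)
    (hε : 0 < ε) :
    ∃ η R : ℝ, 0 < η ∧ 0 < R ∧ ∀ (Λ : Fin 3 → ℂ) (A B : Fin 3 → Fin 3 → ℂ),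
      (∀ j l, ‖A j l‖ ≤ C₀) → (∀ j, ‖A j j‖ ≤ η) → (∀ j l, ‖B j l‖ ≤ η) →
      (∀ j l, j ≠ l → R ≤ ‖Λ l - Λ j‖) → ∀ (c : Fin 3) (a : ℂ) (f : Fin 3 → (ℝ →ᵇ ℂ)),
        f = Pi.single c (BoundedContinuousFunction.const ℝ a) + columnOp h c Λ A B f →
          ‖columnOp h c Λ A B f‖ ≤ ε * ‖f‖ := by
  obtain ⟨φ, hφ, hφ1, hφε⟩ := exists_smooth_approx h (ε := ε / (9 * C₀)) (by positivity)
  obtain ⟨Mφ, hMφ⟩ := hφ.exists_bound_of_continuous hφ1.continuous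
  have hφd : ∀ x, HasDerivAt φ (deriv φ x) x := fun x =>
    (hφ1.differentiable one_ne_zero x).hasDerivAt
  have hφ' : Continuous (deriv φ) := hφ1.continuous_deriv_one
  set Np := ∫ ξ, ‖p ξ‖
  set Nr := ∫ ξ, ‖r ξ‖
  have hNp : 0 ≤ Np := integral_nonneg fun _ => norm_nonneg _
  have hNr : 0 ≤ Nr := integral_nonneg fun _ => norm_nonneg _
  have hM0 : 0 ≤ Mφ := (norm_nonneg _).trans (hMφ 0)
  set g : ℝ → ℝ := fun ξ => ‖deriv φ ξ‖ + Mφ * (3 * (C₀ * ‖p ξ‖ + ‖r ξ‖)) with hg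
  have hgi : Integrable g := by
    have h1 : Integrable (deriv φ) := hφ'.integrable_of_hasCompactSupport hφ.deriv
    exact h1.norm.add ((((h.integrable_fst.norm.const_mul C₀).add
      h.integrable_snd.norm).const_mul 3).const_mul Mφ)
  set D := Mφ + ∫ ξ, g ξ
  have hD : 0 ≤ D := add_nonneg hM0 (integral_nonneg fun ξ => by positivity)
  -- The budget is `ε/3` for each of the three values of `l`: `ε/9` for the small coefficients,
  -- `ε/9` for replacing `p` by `Q φ`, and `ε/9` for the integration by parts. The added `1` in `Np
  -- + Nr + 1` and in `D + 1` keeps denominators and `R` positive.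
  set η := min 1 (ε / (9 * (Np + Nr + 1)))
  set R := 9 * C₀ * (D + 1) / ε
  have hη1 : η ≤ 1 := min_le_left _ _
  have hηN : η * (Np + Nr) ≤ ε / 9 := by
    have h1 : η * (9 * (Np + Nr + 1)) ≤ ε :=
      (le_div_iff₀ (by positivity)).mp (min_le_right _ _)
    have h2 : 0 < η := lt_min one_pos (by positivity)
    nlinarith
  have hη0 : 0 < η := lt_min one_pos (by positivity)
  have hR0 : 0 < R := by positivity
  refine ⟨η, R, hη0, hR0, ?_⟩
  intro Λ A B hA hAd hB hΛ c a f hf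
  refine (pi_norm_le_iff_of_nonneg (by positivity)).mpr fun j => ?_
  refine (BoundedContinuousFunction.norm_le (by positivity)).mpr fun x => ?_
  rw [columnOp_apply_eq_sum]
  have hr : ∀ l, ‖B j l * ∫ ξ, expKernel (Λ c - Λ j) (y ξ - y x) * (r ξ * f l ξ)‖ ≤
      η * Nr * ‖f‖ := by
    intro l
    rw [norm_mul, mul_assoc]
    exact mul_le_mul (hB j l) (norm_integral_expKernel_mul_le _ y x h.integrable_snd f l)
      (norm_nonneg _) hη0.le
  have hQ' : Continuous fun x => (Q x : ℂ) := Complex.continuous_ofReal.comp h.continuous_speed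
  have hp : ∀ l, ‖A j l * ∫ ξ, expKernel (Λ c - Λ j) (y ξ - y x) * (p ξ * f l ξ)‖ ≤
      (η * Np + 2 * ε / 9) * ‖f‖ := by
    intro l
    rcases eq_or_ne j l with rfl | hjl
    · rw [norm_mul]
      have h1 := mul_le_mul (hAd j) (norm_integral_expKernel_mul_le (Λ c - Λ j) y x
        h.integrable_fst f j) (norm_nonneg _) hη0.le
      refine h1.trans ?_
      rw [← mul_assoc]
      gcongr
      linarith [hε.le]
    · have iQ : Integrable fun ξ => (Q ξ : ℂ) * φ ξ :=
        Continuous.integrable_of_hasCompactSupport (by have := hφ1.continuous; fun_prop) hφ.mul_left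
      have i1 : Integrable fun ξ => expKernel (Λ c - Λ j) (y ξ - y x) * (Q ξ * φ ξ * f l ξ) :=
        integrable_expKernel_mul h.isPhase _ x (integrable_mul_bcf iQ (f l))
      have i2 : Integrable fun ξ =>
          expKernel (Λ c - Λ j) (y ξ - y x) * ((p ξ - Q ξ * φ ξ) * f l ξ) :=
        integrable_expKernel_mul h.isPhase _ x (integrable_mul_bcf (h.integrable_fst.sub iQ) (f l))
      have hsplit : ∫ ξ, expKernel (Λ c - Λ j) (y ξ - y x) * (p ξ * f l ξ) =
          (∫ ξ, expKernel (Λ c - Λ j) (y ξ - y x) * ((p ξ - Q ξ * φ ξ) * f l ξ)) +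
            ∫ ξ, expKernel (Λ c - Λ j) (y ξ - y x) * (Q ξ * φ ξ * f l ξ) := by
        rw [← integral_add i2 i1]
        congr 1 with ξ
        ring
      have b1 : ‖∫ ξ, expKernel (Λ c - Λ j) (y ξ - y x) * ((p ξ - Q ξ * φ ξ) * f l ξ)‖ ≤
          ε / (9 * C₀) * ‖f‖ :=
        (norm_integral_expKernel_mul_le _ y x (h.integrable_fst.sub iQ) f l).trans
          (mul_le_mul_of_nonneg_right hφε (norm_nonneg _))
      have hfn : ∀ ξ, ‖f l ξ‖ ≤ ‖f‖ := fun ξ =>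
        ((f l).norm_coe_le_norm ξ).trans (norm_le_pi_norm f l)
      -- The exponents combine to `Λ l - Λ j`, independent of `c`. The gain thus persists in row `j
      -- = c`, where the kernel itself does not oscillate but `f l` does.
      have b2 := norm_mul_integral_expKernel_le h.isPhase.strictMono h.hasDerivAt
        h.continuous_speed (Λ c - Λ j) (-(Λ c - Λ l)) hφ hφd hφ'
        (hasDerivAt_of_eq_columnOp h c Λ A B hf l) (continuous_potentialMul h A B f l) x
      have b3 : ‖φ x‖ * ‖f l x‖ + ∫ ξ, ‖deriv φ ξ * f l ξ +
          φ ξ * potentialMul p r A B (fun l => f l) l ξ‖ ≤ D * ‖f‖ := by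
        rw [add_mul, ← integral_mul_const]
        refine add_le_add (mul_le_mul (hMφ x) (hfn x) (norm_nonneg _) hM0) ?_
        refine integral_mono_of_nonneg (ae_of_all _ fun _ => norm_nonneg _)
          (hgi.mul_const _) (ae_of_all _ fun ξ => ?_)
        refine (norm_add_le _ _).trans ?_
        simp only [hg, norm_mul, add_mul]
        refine add_le_add (mul_le_mul_of_nonneg_left (hfn ξ) (norm_nonneg _)) ?_
        rw [mul_assoc Mφ]
        exact mul_le_mul (hMφ ξ) (norm_potentialMul_le hA (fun j l => (hB j l).trans hη1) f l ξ)
          (norm_nonneg _) hM0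
      have b4 : R * ‖∫ ξ, expKernel (Λ c - Λ j) (y ξ - y x) * (Q ξ * φ ξ * f l ξ)‖ ≤
          D * ‖f‖ := by
        refine le_trans ?_ (b2.trans b3)
        rw [norm_mul]
        refine mul_le_mul_of_nonneg_right ?_ (norm_nonneg _)
        rw [show Λ c - Λ j + -(Λ c - Λ l) = Λ l - Λ j by ring]
        exact hΛ j l hjl
      have b5 : C₀ * ‖∫ ξ, expKernel (Λ c - Λ j) (y ξ - y x) * (Q ξ * φ ξ * f l ξ)‖ ≤
          ε / 9 * ‖f‖ := by
        set I := ‖∫ ξ, expKernel (Λ c - Λ j) (y ξ - y x) * (Q ξ * φ ξ * f l ξ)‖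
        have h1 : R * I ≤ (D + 1) * ‖f‖ := b4.trans (by gcongr; linarith)
        have h2 : C₀ * I = ε / (9 * (D + 1)) * (R * I) := by
          simp only [R]; field_simp
        rw [h2]
        calc ε / (9 * (D + 1)) * (R * I) ≤ ε / (9 * (D + 1)) * ((D + 1) * ‖f‖) := by gcongr
          _ = ε / 9 * ‖f‖ := by field_simp
      have b6 : C₀ * (ε / (9 * C₀) * ‖f‖) = ε / 9 * ‖f‖ := by field_simp
      rw [norm_mul, hsplit]
      calc ‖A j l‖ * ‖_ + _‖ ≤ C₀ * (_ + _) :=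
            mul_le_mul (hA j l) (norm_add_le _ _) (norm_nonneg _) hC₀.le
        _ ≤ C₀ * (ε / (9 * C₀) * ‖f‖) +
            C₀ * ‖∫ ξ, expKernel (Λ c - Λ j) (y ξ - y x) * (Q ξ * φ ξ * f l ξ)‖ := by
          rw [mul_add]; gcongr
        _ ≤ ε / 9 * ‖f‖ + ε / 9 * ‖f‖ := by rw [b6]; gcongr
        _ ≤ (η * Np + 2 * ε / 9) * ‖f‖ := by nlinarith [mul_nonneg hη0.le hNp, norm_nonneg f]
  refine (norm_sum_le_of_le _ fun l _ => (norm_add_le _ _).trans (add_le_add (hp l) (hr l))).trans ?_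
  simp only [Finset.sum_const, Finset.card_univ, Fintype.card_fin, nsmul_eq_mul]
  push_cast
  nlinarith [norm_nonneg f]

end LargeParameter

/-! ### The spectral functions -/

theorem cubeRoot_pow_three : cubeRoot ^ 3 = 1 := by
  rw [cubeRoot, ← Complex.exp_nat_mul]
  convert Complex.exp_two_pi_mul_I using 2
  push_cast
  ring

theorem cubeRoot_ne_zero : cubeRoot ≠ 0 := Complex.exp_ne_zero _

theorem norm_cubeRoot_pow (n : ℕ) : ‖cubeRoot ^ n‖ = 1 := by
  have : ‖cubeRoot‖ = 1 := by
    rw [cubeRoot, Complex.norm_exp]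
    simp
  rw [norm_pow, this, one_pow]

theorem ofReal_sqrt_three_sq : (Real.sqrt 3 : ℂ) ^ 2 = 3 := by
  rw [← Complex.ofReal_pow, Real.sq_sqrt (by norm_num)]
  norm_num

theorem ofReal_sqrt_three_ne_zero : (Real.sqrt 3 : ℂ) ≠ 0 := by
  rw [Complex.ofReal_ne_zero]
  positivity

/-- The right-hand side is independent of `j`: the `λ_j` are roots of a single cubic `λ³ - λ =
const`, and the algebra of `P` follows from this. -/
theorem lam_pow_three_sub (j : Fin 3) {k : ℂ} (hk : k ≠ 0) :
    lam j k ^ 3 - lam j k = (k ^ 3 + (k ^ 3)⁻¹) / (Real.sqrt 3 : ℂ) ^ 3 := by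
  have hc : cubeRoot ^ (j.val + 1) ≠ 0 := pow_ne_zero _ cubeRoot_ne_zero
  have h3 : (cubeRoot ^ (j.val + 1)) ^ 3 = 1 := by
    rw [← pow_mul, mul_comm, pow_mul, cubeRoot_pow_three, one_pow]
  have hs := ofReal_sqrt_three_ne_zero
  have hs2 := ofReal_sqrt_three_sq
  set s : ℂ := (Real.sqrt 3 : ℂ)
  set a := cubeRoot ^ (j.val + 1)
  have hz : (a * k) ^ 3 = k ^ 3 := by rw [mul_pow, h3, one_mul]
  have hak : a * k ≠ 0 := mul_ne_zero hc hk
  rw [← hz]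
  have : lam j k = (a * k + (a * k)⁻¹) / s := rfl
  rw [this]
  generalize a * k = z at hak
  field_simp
  rw [hs2]
  ring

/-- Since `Re (1/z) = Re z / |z|²`, the positive factor on the right is common to all `j`. So the
contour is invariant under positive scaling. -/
theorem re_lam (j : Fin 3) (k : ℂ) :
    (lam j k).re = (cubeRoot ^ (j.val + 1) * k).re * ((1 + (‖k‖ ^ 2)⁻¹) / Real.sqrt 3) := by
  have hn : Complex.normSq (cubeRoot ^ (j.val + 1) * k) = ‖k‖ ^ 2 := by
    rw [Complex.normSq_eq_norm_sq, norm_mul, norm_cubeRoot_pow, one_mul]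
  rw [lam, Complex.div_ofReal_re, Complex.add_re, Complex.inv_re, hn]
  ring

theorem re_lam_eq_iff (j l : Fin 3) {k : ℂ} (hk : k ≠ 0) : (lam j k).re = (lam l k).re ↔
    (cubeRoot ^ (j.val + 1) * k).re = (cubeRoot ^ (l.val + 1) * k).re := by
  rw [re_lam j k, re_lam l k]
  exact mul_left_inj' (by positivity)

theorem zero_mem_contour : (0 : ℂ) ∈ contour := ⟨0, 1, by decide, by simp [lam]⟩

theorem ne_zero_of_notMem_contour {k : ℂ} (hk : k ∈ contourᶜ) : k ≠ 0 := by
  rintro rfl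
  exact hk zero_mem_contour

theorem re_lam_ne {k : ℂ} (hk : k ∈ contourᶜ) {j l : Fin 3} (h : j ≠ l) :
    (lam j k).re ≠ (lam l k).re := fun he => hk ⟨j, l, h, he⟩

theorem lam_ne {k : ℂ} (hk : k ∈ contourᶜ) {j l : Fin 3} (h : j ≠ l) : lam j k ≠ lam l k :=
  fun he => re_lam_ne hk h (congrArg Complex.re he)

theorem smul_mem_contour_compl {k : ℂ} (hk : k ∈ contourᶜ) {s : ℝ} (hs : 0 < s) :
    (s : ℂ) * k ∈ contourᶜ := by
  rintro ⟨j, l, hjl, h⟩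
  have hk0 := ne_zero_of_notMem_contour hk
  have hs0 : (s : ℂ) ≠ 0 := Complex.ofReal_ne_zero.mpr hs.ne'
  rw [re_lam_eq_iff j l (mul_ne_zero hs0 hk0)] at h
  refine hk ⟨j, l, hjl, (re_lam_eq_iff j l hk0).mpr ?_⟩
  rw [mul_left_comm, mul_left_comm _ (s : ℂ), Complex.re_ofReal_mul, Complex.re_ofReal_mul] at h
  exact mul_left_cancel₀ hs.ne' h

theorem analyticAt_lam (j : Fin 3) {k : ℂ} (hk : k ≠ 0) : AnalyticAt ℂ (lam j) k := by
  have h1 : AnalyticAt ℂ (fun k => cubeRoot ^ (j.val + 1) * k) k :=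
    analyticAt_const.mul analyticAt_id
  exact (h1.add (h1.inv (mul_ne_zero (pow_ne_zero _ cubeRoot_ne_zero) hk))).div analyticAt_const
    ofReal_sqrt_three_ne_zero

theorem eventually_notMem_contour {k : ℂ} (hk : k ∈ contourᶜ) : ∀ᶠ k' in 𝓝 k, k' ∈ contourᶜ := by
  have h : ∀ j l : Fin 3, ∀ᶠ k' in 𝓝 k, j ≠ l → (lam j k').re ≠ (lam l k').re := by
    intro j l
    have hc : ∀ j, ContinuousAt (fun k => (lam j k).re) k := fun j =>
      Complex.continuous_re.continuousAt.comp
        (analyticAt_lam j (ne_zero_of_notMem_contour hk)).continuousAt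
    rcases eq_or_ne j l with rfl | hjl
    · simp
    · filter_upwards [((hc j).sub (hc l)).eventually_ne (sub_ne_zero.mpr (re_lam_ne hk hjl))]
        with k' hk' _
      exact sub_ne_zero.mp hk'
  filter_upwards [eventually_all.mpr fun j => eventually_all.mpr fun l => h j l] with k' hk'
  rintro ⟨j, l, hjl, he⟩
  exact hk' j l hjl he

theorem lam_quadratic {k : ℂ} (hk : k ∈ contourᶜ) {j l : Fin 3} (h : j ≠ l) :
    lam j k ^ 2 + lam j k * lam l k + lam l k ^ 2 = 1 := by
  have h1 := lam_pow_three_sub j (ne_zero_of_notMem_contour hk)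
  have h2 := lam_pow_three_sub l (ne_zero_of_notMem_contour hk)
  refine mul_left_cancel₀ (sub_ne_zero.mpr (lam_ne hk h)) ?_
  linear_combination h1 - h2

/-- This is the derivative of the cubic at one of its roots, and off the contour the three roots are
distinct. -/
theorem three_mul_lam_sq_sub_one_ne_zero {k : ℂ} (hk : k ∈ contourᶜ) (j : Fin 3) :
    3 * lam j k ^ 2 - 1 ≠ 0 := by
  intro h0
  have key : ∀ l, j ≠ l → lam l k = -2 * lam j k := by
    intro l hl
    have h1 := lam_quadratic hk hl
    have h2 : (lam l k - lam j k) * (lam l k + 2 * lam j k) = 0 := by linear_combination h1 - h0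
    have := (mul_eq_zero.mp h2).resolve_left (sub_ne_zero.mpr (lam_ne hk hl.symm))
    linear_combination this
  have hex : ∀ j : Fin 3, ∃ m n : Fin 3, j ≠ m ∧ j ≠ n ∧ m ≠ n := by decide
  obtain ⟨m, n, hm, hn, hmn⟩ := hex j
  exact lam_ne hk hmn ((key m hm).trans (key n hn).symm)

/-- The coefficients of `q_x / q` in `Û`. -/
noncomputable def coeffFst (k : ℂ) (j l : Fin 3) : ℂ :=
  (lam j k ^ 2 - 1 - lam l k ^ 2) / (3 * lam j k ^ 2 - 1)

/-- The coefficients of `1 / q - q` in `Û`. -/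
noncomputable def coeffSnd (k : ℂ) (j l : Fin 3) : ℂ := lam l k / (3 * lam j k ^ 2 - 1)

/-- `P` is a Vandermonde matrix. Row `j` of its inverse lists the coefficients of the Lagrange
polynomial `(z² + λ_j z + λ_j² - 1) / (3 λ_j² - 1)`. -/
theorem P_inv {k : ℂ} (hk : k ∈ contourᶜ) : (P k)⁻¹ = Matrix.of fun j a : Fin 3 =>
    ![lam j k ^ 2 - 1, lam j k, 1] a / (3 * lam j k ^ 2 - 1) := by
  refine Matrix.inv_eq_left_inv ?_
  ext j l
  have hD := three_mul_lam_sq_sub_one_ne_zero hk j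
  simp only [Matrix.mul_apply, Matrix.of_apply, P, Fin.sum_univ_three]
  simp only [Fin.isValue, Fin.val_zero, pow_zero, Fin.val_one, pow_one, Fin.val_two,
    Matrix.cons_val_zero, Matrix.cons_val_one, Matrix.cons_val_two, Matrix.tail_cons,
    Matrix.head_cons, div_mul_eq_mul_div, ← add_div]
  rcases eq_or_ne j l with rfl | hjl
  · rw [Matrix.one_apply_eq, div_eq_one_iff_eq hD]
    ring
  · rw [Matrix.one_apply_ne hjl, div_eq_zero_iff]
    left
    linear_combination lam_quadratic hk hjl

theorem Uhat_apply (u : ℝ → ℝ → ℝ) (x t : ℝ) {k : ℂ} (hk : k ∈ contourᶜ) (j l : Fin 3) :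
    Uhat u x t k j l = coeffFst k j l * (qx u x t / q u x t : ℝ) +
      coeffSnd k j l * (1 / q u x t - q u x t : ℝ) := by
  rw [Uhat, P_inv hk, Matrix.mul_assoc, Matrix.mul_apply]
  simp only [Matrix.mul_apply, Matrix.of_apply, P, Fin.sum_univ_three, Utilde, Matrix.map_apply,
    coeffFst, coeffSnd]
  simp
  ring

theorem analyticAt_coeffFst {k : ℂ} (hk : k ∈ contourᶜ) (j l : Fin 3) :
    AnalyticAt ℂ (fun k => coeffFst k j l) k := by
  have h := fun j => analyticAt_lam j (ne_zero_of_notMem_contour hk)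
  exact ((((h j).pow 2).sub analyticAt_const).sub ((h l).pow 2)).div
    ((analyticAt_const.mul ((h j).pow 2)).sub analyticAt_const)
    (three_mul_lam_sq_sub_one_ne_zero hk j)

theorem analyticAt_coeffSnd {k : ℂ} (hk : k ∈ contourᶜ) (j l : Fin 3) :
    AnalyticAt ℂ (fun k => coeffSnd k j l) k := by
  have h := fun j => analyticAt_lam j (ne_zero_of_notMem_contour hk)
  exact (h l).div ((analyticAt_const.mul ((h j).pow 2)).sub analyticAt_const)
    (three_mul_lam_sq_sub_one_ne_zero hk j)

theorem norm_lam_bounds (j : Fin 3) {k : ℂ} (hk : 1 ≤ ‖k‖) :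
    ‖k‖ - 1 ≤ Real.sqrt 3 * ‖lam j k‖ ∧ Real.sqrt 3 * ‖lam j k‖ ≤ ‖k‖ + 1 := by
  have h1 : Real.sqrt 3 * ‖lam j k‖ =
      ‖cubeRoot ^ (j.val + 1) * k + (cubeRoot ^ (j.val + 1) * k)⁻¹‖ := by
    rw [lam, norm_div, Complex.norm_real, Real.norm_of_nonneg (Real.sqrt_nonneg 3)]
    field_simp
  have h2 : ‖cubeRoot ^ (j.val + 1) * k‖ = ‖k‖ := by rw [norm_mul, norm_cubeRoot_pow, one_mul]
  have h3 : ‖(cubeRoot ^ (j.val + 1) * k)⁻¹‖ ≤ 1 := by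
    rw [norm_inv, h2]; exact inv_le_one_of_one_le₀ hk
  rw [h1]
  constructor
  · have := norm_sub_le_norm_add (cubeRoot ^ (j.val + 1) * k) (cubeRoot ^ (j.val + 1) * k)⁻¹
    rw [h2] at this
    linarith
  · have := norm_add_le (cubeRoot ^ (j.val + 1) * k) (cubeRoot ^ (j.val + 1) * k)⁻¹
    rw [h2] at this
    linarith

/-- The off-diagonal coefficients of `q_x / q` are only bounded; the separation of the `λ_j`
compensates for this. The threshold `4` is where `(K - 1)² - 1 ≥ K²/2` begins to hold. -/
theorem spectral_bounds {k : ℂ} (hk : k ∈ contourᶜ) (hk4 : 4 ≤ ‖k‖) :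
    (∀ j l, ‖coeffFst k j l‖ ≤ 6) ∧ (∀ j, ‖coeffFst k j j‖ ≤ 4 / ‖k‖) ∧
    (∀ j l, ‖coeffSnd k j l‖ ≤ 4 / ‖k‖) ∧ ∀ j l, j ≠ l → ‖k‖ / 2 ≤ ‖lam l k - lam j k‖ := by
  have hb := fun j => norm_lam_bounds j (k := k) (by linarith)
  have hs : Real.sqrt 3 ^ 2 = 3 := Real.sq_sqrt (by norm_num)
  have hs0 : 0 ≤ Real.sqrt 3 := Real.sqrt_nonneg 3
  have hs1 : 1 ≤ Real.sqrt 3 := by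
    rw [Real.one_le_sqrt]; norm_num
  set K := ‖k‖
  have hsq : ∀ j, 3 * ‖lam j k‖ ^ 2 ≤ (K + 1) ^ 2 := fun j => by
    rw [← hs, ← mul_pow]
    exact pow_le_pow_left₀ (by positivity) (hb j).2 2
  have hlow : ∀ j l, (K - 1) ^ 2 ≤ 3 * (‖lam j k‖ * ‖lam l k‖) := fun j l => by
    have := mul_le_mul (hb j).1 (hb l).1 (by linarith) (by positivity)
    nlinarith
  have hD : ∀ j, K ^ 2 / 2 ≤ ‖3 * lam j k ^ 2 - 1‖ := fun j => by
    have h1 := norm_sub_norm_le (3 * lam j k ^ 2) 1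
    rw [norm_mul, norm_pow, norm_one, Complex.norm_ofNat] at h1
    nlinarith [hlow j j]
  have hD0 : 0 < K ^ 2 / 2 := by positivity
  refine ⟨fun j l => ?_, fun j => ?_, fun j l => ?_, fun j l hjl => ?_⟩
  · rw [coeffFst, norm_div, div_le_iff₀ (hD0.trans_le (hD j))]
    have h1 : ‖lam j k ^ 2 - 1 - lam l k ^ 2‖ ≤ ‖lam j k‖ ^ 2 + 1 + ‖lam l k‖ ^ 2 := by
      refine (norm_sub_le _ _).trans ?_
      rw [norm_pow]
      gcongr
      refine (norm_sub_le _ _).trans ?_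
      rw [norm_pow, norm_one]
    nlinarith [hsq j, hsq l, hD j]
  · have : coeffFst k j j = -(1 / (3 * lam j k ^ 2 - 1)) := by rw [coeffFst]; ring
    rw [this, norm_neg, norm_div, norm_one, div_le_div_iff₀ (hD0.trans_le (hD j)) (by linarith)]
    nlinarith [hD j]
  · rw [coeffSnd, norm_div, div_le_div_iff₀ (hD0.trans_le (hD j)) (by linarith)]
    have h1 : ‖lam l k‖ ≤ K + 1 := by nlinarith [(hb l).2, norm_nonneg (lam l k)]
    nlinarith [hD j]
  -- The quadratic relation turns the squared difference into `1 - 3 λ_j λ_l`, so a lower bound for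
  -- the product suffices and the angle of `k` plays no role.
  · have h1 : (lam l k - lam j k) ^ 2 = 1 - 3 * (lam j k * lam l k) := by
      linear_combination lam_quadratic hk hjl
    have h2 := norm_sub_norm_le (3 * (lam j k * lam l k)) 1
    rw [norm_sub_rev, ← h1, norm_pow, norm_mul, norm_mul, norm_one, Complex.norm_ofNat] at h2
    have h3 := hlow j l
    by_contra! hlt
    nlinarith [norm_nonneg (lam l k - lam j k)]

/-! ### The system at a fixed time -/

theorem integrable_ofReal_of_abs_le {g : ℝ → ℝ} (hg : Continuous g) {C : ℝ}
    (h : ∀ x, |g x| ≤ C / (1 + x ^ 2)) : Integrable fun x => (g x : ℂ) := by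
  refine Integrable.ofReal ((integrable_inv_one_add_sq.const_mul C).mono' hg.aestronglyMeasurable
    (ae_of_all _ fun x => ?_))
  rw [Real.norm_eq_abs, ← div_eq_mul_inv]
  exact h x

theorem continuous_slice {F : ℝ × ℝ → ℝ} (hF : ContinuousOn F (univ ×ˢ Ici 0)) {t : ℝ}
    (ht : 0 ≤ t) : Continuous fun x => F (x, t) :=
  hF.comp_continuous (by fun_prop) fun x => mk_mem_prod (mem_univ x) ht

/-- With `w = m + 1`, one has `q_x / q = w_x / (3w)` and `|1/q - q| ≤ |m| / q`. The lower bound on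
`w` and the decay of `u` make both `O(1/(1 + x²))`. -/
theorem IsSolution.isScattering {u₀ : ℝ → ℝ} {u : ℝ → ℝ → ℝ} (hu : IsSolution u₀ u)
    (hpos : ∀ x : ℝ, 0 < u₀ x - iteratedDeriv 2 u₀ x + 1) {t : ℝ} (ht : 0 ≤ t) :
    IsScattering (fun x => ∫ ζ in (0 : ℝ)..x, q u ζ t) (fun x => q u x t)
      (fun x => ((qx u x t / q u x t : ℝ) : ℂ)) (fun x => ((1 / q u x t - q u x t : ℝ) : ℂ)) := by
  obtain ⟨c, hc, hcw⟩ := hu.exists_momentum_lower_bound hpos ht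
  obtain ⟨C, hC0, hC⟩ := hu.exists_decay t
  have htt : t ∈ Icc 0 t := ⟨ht, le_rfl⟩
  have hwpos : ∀ x, 0 < momentum u x t + 1 := fun x => hc.trans_le (hcw x)
  have hwd := fun x => hu.hasDerivAt_momentum x ht
  have hwc : Continuous fun x => momentum u x t + 1 :=
    continuous_iff_continuousAt.mpr fun x => (hwd x).continuousAt
  have hqc : Continuous fun x => q u x t :=
    hwc.rpow_const fun x => Or.inl (hwpos x).ne'
  have hqlow : ∀ x, c ^ (1 / 3 : ℝ) ≤ q u x t := fun x =>
    Real.rpow_le_rpow hc.le (hcw x) (by norm_num)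
  have hc3 : 0 < c ^ (1 / 3 : ℝ) := Real.rpow_pos_of_pos hc _
  have hqpos : ∀ x, 0 < q u x t := fun x => hc3.trans_le (hqlow x)
  have hmom : ∀ x, |momentum u x t| ≤ 2 * C / (1 + x ^ 2) := fun x => by
    have h0 := hC 0 (by norm_num) x t htt
    have h2 := hC 2 (by norm_num) x t htt
    rw [dx_zero] at h0
    rw [momentum, two_mul, add_div]
    exact (abs_sub _ _).trans (add_le_add h0 h2)
  have hwx : ∀ x, |dx 1 u x t - dx 3 u x t| ≤ 2 * C / (1 + x ^ 2) := fun x => by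
    rw [two_mul, add_div]
    exact (abs_sub _ _).trans
      (add_le_add (hC 1 (by norm_num) x t htt) (hC 3 (by norm_num) x t htt))
  have hwxc : Continuous fun x => dx 1 u x t - dx 3 u x t := by
    obtain ⟨h1, -, h3, -⟩ := hu.contDiffOn_dx
    exact (continuous_slice h1.continuousOn ht).sub (continuous_slice h3.continuousOn ht)
  have hlog : ∀ x, qx u x t / q u x t =
      (dx 1 u x t - dx 3 u x t) / (3 * (momentum u x t + 1)) := fun x => by
    have h1 : qx u x t = _ := ((hwd x).rpow_const (p := 1 / 3) (Or.inl (hwpos x).ne')).deriv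
    have hw := (hwpos x).ne'
    have hq := (hqpos x).ne'
    rw [h1, Real.rpow_sub_one hw]
    unfold q at hq ⊢
    field_simp
  have hcube : ∀ x, q u x t ^ 3 = momentum u x t + 1 := fun x => by
    rw [q, ← Real.rpow_natCast, ← Real.rpow_mul (hwpos x).le]
    norm_num
  have hpc : Continuous fun x => qx u x t / q u x t := by
    simp only [hlog]
    exact hwxc.div (continuous_const.mul hwc) fun x => by
      have := hwpos x
      positivity
  have hrc : Continuous fun x => 1 / q u x t - q u x t :=
    (continuous_const.div hqc fun x => (hqpos x).ne').sub hqc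
  refine ⟨fun x => (hqc.integral_hasStrictDerivAt 0 x).hasDerivAt, hqc, ⟨_, hc3, hqlow⟩,
    ⟨(2 * C + 1) ^ (1 / 3 : ℝ), fun x => ?_⟩, Complex.continuous_ofReal.comp hpc,
    integrable_ofReal_of_abs_le (C := 2 * C / (3 * c)) hpc fun x => ?_,
    Complex.continuous_ofReal.comp hrc,
    integrable_ofReal_of_abs_le (C := 2 * C / c ^ (1 / 3 : ℝ)) hrc fun x => ?_⟩
  · refine Real.rpow_le_rpow (hwpos x).le ?_ (by norm_num)
    have h1 : 2 * C / (1 + x ^ 2) ≤ 2 * C :=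
      div_le_self (by positivity) (by nlinarith [sq_nonneg x])
    linarith [le_abs_self (momentum u x t), hmom x]
  · rw [hlog, abs_div, div_right_comm, abs_of_pos (a := 3 * (momentum u x t + 1)) (by have := hwpos x; positivity)]
    exact div_le_div₀ (by positivity) (hwx x) (by positivity) (by linarith [hcw x])
  · have hq := hqpos x
    -- From `q³ - 1 = m`; the factor `q² + q + 1` dominates the `q + 1` that occurs in `1/q - q`.
    have h1 : |q u x t - 1| * (q u x t ^ 2 + q u x t + 1) = |momentum u x t| := by
      have h2 : momentum u x t = (q u x t - 1) * (q u x t ^ 2 + q u x t + 1) := by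
        linear_combination -hcube x
      rw [h2, abs_mul, abs_of_pos (a := q u x t ^ 2 + q u x t + 1) (by positivity)]
    have h3 : 1 / q u x t - q u x t = -((q u x t - 1) * (q u x t + 1)) / q u x t := by
      field_simp
      ring
    rw [h3, abs_div, abs_neg, abs_mul, abs_of_pos hq, abs_of_pos (a := q u x t + 1) (by positivity),
      div_right_comm]
    refine div_le_div₀ (by positivity) ?_ hc3 (hqlow x)
    refine le_trans ?_ (h1.le.trans (hmom x))
    exact mul_le_mul_of_nonneg_left (by nlinarith [sq_nonneg (q u x t)]) (abs_nonneg _)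

/-! ### Translation between the matrix system and the column equations. -/

section Bridge

open scoped BoundedContinuousFunction

variable {u : ℝ → ℝ → ℝ} {t : ℝ} {k : ℂ}

/-- The data of the integral system at time `t`. -/
abbrev IsScatteringAt (u : ℝ → ℝ → ℝ) (t : ℝ) : Prop :=
  IsScattering (fun x => ∫ ζ in (0 : ℝ)..x, q u ζ t) (fun x => q u x t)
    (fun x => ((qx u x t / q u x t : ℝ) : ℂ)) (fun x => ((1 / q u x t - q u x t : ℝ) : ℂ))

/-- The operator of the `c`-th column of the system at time `t`. -/
noncomputable def systemOp (h : IsScatteringAt u t) (c : Fin 3) (k : ℂ) :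
    (Fin 3 → (ℝ →ᵇ ℂ)) →L[ℂ] (Fin 3 → (ℝ →ᵇ ℂ)) :=
  columnOp h c (fun j => lam j k) (coeffFst k) (coeffSnd k)

/-- The `c`-th column of the identity matrix. -/
noncomputable def unitColumn (c : Fin 3) (a : ℂ) : Fin 3 → (ℝ →ᵇ ℂ) :=
  Pi.single c (BoundedContinuousFunction.const ℝ a)

theorem integralFromInfty_eq (h : IsScatteringAt u t) (j l : Fin 3) (k : ℂ) (V : ℝ → ℂ) (x : ℝ) :
    integralFromInfty j l k (fun ξ =>
      Complex.exp (-lam j k * ((∫ ζ in x..ξ, q u ζ t : ℝ) : ℂ)) * V ξ *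
        Complex.exp (lam l k * ((∫ ζ in x..ξ, q u ζ t : ℝ) : ℂ))) x =
      ∫ ξ, expKernel (lam l k - lam j k)
        ((∫ ζ in (0 : ℝ)..ξ, q u ζ t) - ∫ ζ in (0 : ℝ)..x, q u ζ t) * V ξ := by
  have hq : ∀ a b, IntervalIntegrable (fun ζ => q u ζ t) volume a b := fun a b =>
    h.continuous_speed.intervalIntegrable a b
  have h1 : ∀ ξ, Complex.exp (-lam j k * ((∫ ζ in x..ξ, q u ζ t : ℝ) : ℂ)) * V ξ *
        Complex.exp (lam l k * ((∫ ζ in x..ξ, q u ζ t : ℝ) : ℂ)) =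
      Complex.exp ((lam l k - lam j k) *
        ((∫ ζ in (0 : ℝ)..ξ, q u ζ t) - ∫ ζ in (0 : ℝ)..x, q u ζ t : ℝ)) * V ξ := by
    intro ξ
    rw [intervalIntegral.integral_interval_sub_left (hq 0 ξ) (hq 0 x), mul_right_comm,
      ← Complex.exp_add]
    congr 2
    ring
  simp only [h1, integralFromInfty]
  by_cases hre : (lam j k).re ≥ (lam l k).re
  · rw [if_pos hre, integral_expKernel_of_nonpos h.isPhase.strictMono
      (by rw [Complex.sub_re]; linarith)]
  · rw [if_neg hre, integral_expKernel_of_pos h.isPhase.strictMono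
      (by rw [Complex.sub_re]; push Not at hre ⊢; linarith)]

theorem systemOp_apply (h : IsScatteringAt u t) (hk : k ∈ contourᶜ) (c : Fin 3)
    {N : ℝ → Matrix (Fin 3) (Fin 3) ℂ} {f : Fin 3 → (ℝ →ᵇ ℂ)} (hf : ∀ x j, f j x = N x j c)
    (x : ℝ) (j : Fin 3) : systemOp h c k f j x = integralFromInfty j c k (fun ξ =>
      Complex.exp (-lam j k * ((∫ ζ in x..ξ, q u ζ t : ℝ) : ℂ)) * (Uhat u ξ t k * N ξ) j c *
        Complex.exp (lam c k * ((∫ ζ in x..ξ, q u ζ t : ℝ) : ℂ))) x := by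
  rw [integralFromInfty_eq h, systemOp, columnOp_apply]
  congr 1 with ξ
  rw [Matrix.mul_apply, potentialMul]
  congr 1
  exact Finset.sum_congr rfl fun l _ => by rw [Uhat_apply u ξ t hk, hf]

theorem unitColumn_one_apply (c j : Fin 3) (x : ℝ) :
    unitColumn c 1 j x = (1 : Matrix (Fin 3) (Fin 3) ℂ) j c := by
  rcases eq_or_ne j c with rfl | hj
  · simp [unitColumn]
  · simp [unitColumn, hj]

theorem SolvesIntegralSystem.exists_column (h : IsScatteringAt u t) (hk : k ∈ contourᶜ)
    {N : ℝ → Matrix (Fin 3) (Fin 3) ℂ} (hN : SolvesIntegralSystem u t k N) (c : Fin 3) :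
    ∃ f : Fin 3 → (ℝ →ᵇ ℂ), (∀ x j, f j x = N x j c) ∧
      f = unitColumn c 1 + systemOp h c k f := by
  obtain ⟨C, hC⟩ := hN.bounded
  have hcont : ∀ j, Continuous fun x => N x j c := fun j =>
    (continuous_apply c).comp ((continuous_apply j).comp hN.continuous)
  refine ⟨fun j => BoundedContinuousFunction.ofNormedAddCommGroup (fun x => N x j c) (hcont j) C
    fun x => hC x j c, fun x j => rfl, ?_⟩
  ext j x
  rw [Pi.add_apply, BoundedContinuousFunction.add_apply, unitColumn_one_apply,
    systemOp_apply h hk c (N := N) fun _ _ => rfl]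
  exact hN.equation x j c

theorem solvesIntegralSystem_of_columns (h : IsScatteringAt u t) (hk : k ∈ contourᶜ)
    {F : Fin 3 → Fin 3 → (ℝ →ᵇ ℂ)} (hF : ∀ c, F c = unitColumn c 1 + systemOp h c k (F c)) :
    SolvesIntegralSystem u t k fun x => Matrix.of fun j c => F c j x := by
  refine ⟨?_, ⟨‖F‖, fun x j c => ?_⟩, fun x j c => ?_⟩
  · exact continuous_matrix fun j c => (F c j).continuous
  · exact ((F c j).norm_coe_le_norm x).trans ((norm_le_pi_norm (F c) j).trans (norm_le_pi_norm F c))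
  · rw [← systemOp_apply h hk c (f := F c) (fun _ _ => rfl), ← unitColumn_one_apply c j x,
      ← BoundedContinuousFunction.add_apply, ← Pi.add_apply, ← hF c]
    rfl

/-- If `1 - systemOp` is invertible for each column, the system is uniquely solvable. -/
theorem uniquelySolvable_of_isUnit (h : IsScatteringAt u t) (hk : k ∈ contourᶜ)
    (hunit : ∀ c, IsUnit (1 - systemOp h c k)) : UniquelySolvable u t k := by
  have hinv : ∀ c, ∃ T : (Fin 3 → (ℝ →ᵇ ℂ)) →L[ℂ] (Fin 3 → (ℝ →ᵇ ℂ)),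
      (1 - systemOp h c k) * T = 1 ∧ T * (1 - systemOp h c k) = 1 := fun c =>
    ⟨Ring.inverse _, Ring.mul_inverse_cancel _ (hunit c), Ring.inverse_mul_cancel _ (hunit c)⟩
  choose T hT1 hT2 using hinv
  refine ⟨fun x => Matrix.of fun j c => T c (unitColumn c 1) j x,
    solvesIntegralSystem_of_columns (F := fun c => T c (unitColumn c 1)) h hk fun c => ?_,
    fun N hN => ?_⟩
  · have h1 := congrArg (fun S => S (unitColumn c 1)) (hT1 c)
    simp only [mul_apply_eq_comp, sub_apply, one_apply_eq_self] at h1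
    exact sub_eq_iff_eq_add.mp h1
  · funext x
    ext j c
    obtain ⟨f, hfN, hf⟩ := hN.exists_column h hk c
    have h1 : (1 - systemOp h c k) f = unitColumn c 1 := by
      rw [sub_apply, one_apply_eq_self, sub_eq_iff_eq_add]
      exact hf
    have h2 := congrArg (fun S => S f) (hT2 c)
    simp only [mul_apply_eq_comp, one_apply_eq_self] at h2
    rw [h1] at h2
    rw [Matrix.of_apply, h2, hfN]

end Bridge

/-! ### Solvability off a discrete set -/

section Continuation

variable {X : Type*} [NormedAddCommGroup X] [NormedSpace ℂ X]

theorem isUnit_of_eq_smul_one {S G : X →L[ℂ] X} {d : ℂ} (hd : d ≠ 0) (h1 : S * G = d • 1)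
    (h2 : G * S = d • 1) : IsUnit S :=
  ⟨⟨S, d⁻¹ • G, by rw [mul_smul_comm, h1, inv_smul_smul₀ hd],
    by rw [smul_mul_assoc, h2, inv_smul_smul₀ hd]⟩, rfl⟩

/-- The analytic Fredholm theorem along a path: invertibility at a point with trivial kernel
propagates to a punctured neighbourhood of the initial point. -/
theorem eventually_isUnit_of_path [CompleteSpace X] {A : ℂ → X →L[ℂ] X} {γ : ℝ → ℂ} (hγ : Continuous γ)
    (hA : ∀ s ∈ Ici (1 : ℝ), AnalyticAt ℂ A (γ s))
    (hfin : ∀ s ∈ Ici (1 : ℝ), A (γ s) ∈ finiteRankLimits X X)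
    (hker : ∃ s ∈ Ici (1 : ℝ), ∀ f, A (γ s) f = f → f = 0) :
    ∀ᶠ k in 𝓝[≠] γ 1, IsUnit (1 - A k) := by
  -- Locally the determinant `d` is either identically zero or nonzero in a punctured neighbourhood.
  -- So `U` and `V` are open, disjoint, and cover the half-line `[1, ∞)`.
  set Good : ℂ → Prop := fun k₀ => ∀ᶠ k in 𝓝[≠] k₀, IsUnit (1 - A k)
  set U : Set ℝ := {s | ∀ᶠ k in 𝓝 (γ s), Good k}
  set V : Set ℝ := {s | ∀ᶠ k in 𝓝 (γ s), ¬Good k}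
  have hU : IsOpen U := isOpen_iff_mem_nhds.mpr fun s hs =>
    hγ.continuousAt.eventually (eventually_eventually_nhds.mpr hs)
  have hV : IsOpen V := isOpen_iff_mem_nhds.mpr fun s hs =>
    hγ.continuousAt.eventually (eventually_eventually_nhds.mpr hs)
  have hgoodU : ∀ s, Good (γ s) → s ∈ U := fun s hs => by
    have h1 := eventually_eventually_nhdsWithin.mpr hs
    rw [eventually_nhdsWithin_iff] at h1
    filter_upwards [h1] with k hk
    by_cases h : k = γ s
    · rw [h]; exact hs
    · refine (hk h).filter_mono ?_
      rw [IsOpen.nhdsWithin_eq isOpen_compl_singleton h]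
      exact nhdsWithin_le_nhds
  have hcover : ∀ s ∈ Ici (1 : ℝ), s ∈ U ∪ V := by
    intro s hs
    obtain ⟨d, G, hd, -, hev⟩ := exists_analytic_inverse (hA s hs) (hfin s hs)
    rcases hd.eventually_eq_zero_or_eventually_ne_zero with h0 | h0
    · right
      have hbad : ∀ᶠ k in 𝓝 (γ s), ¬IsUnit (1 - A k) := by
        filter_upwards [h0, hev] with k hk0 hk hu
        obtain ⟨f, hf0, hf⟩ := hk.2.2 hk0
        refine hf0 ?_
        have h1 : (1 - A k) f = 0 := by rw [sub_apply, one_apply_eq_self, hf, sub_self]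
        have h2 := congrArg (fun S => S f) (Ring.inverse_mul_cancel _ hu)
        simpa [h1] using h2.symm
      filter_upwards [eventually_eventually_nhds.mpr hbad] with k hk hgood
      obtain ⟨k', h1, h2⟩ := (hgood.and (hk.filter_mono nhdsWithin_le_nhds)).exists
      exact h2 h1
    · left
      refine hgoodU s ?_
      filter_upwards [h0, hev.filter_mono nhdsWithin_le_nhds] with k hk0 hk
      exact isUnit_of_eq_smul_one hk0 hk.1 hk.2.1
  obtain ⟨s₁, hs₁, hinj⟩ := hker
  have hs₁U : s₁ ∈ U := by
    obtain ⟨d, G, hd, -, hev⟩ := exists_analytic_inverse (hA s₁ hs₁) (hfin s₁ hs₁)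
    refine hgoodU s₁ ?_
    have hd0 : d (γ s₁) ≠ 0 := fun h => by
      obtain ⟨f, hf0, hf⟩ := hev.self_of_nhds.2.2 h
      exact hf0 (hinj f hf)
    filter_upwards [(hd.continuousAt.eventually_ne hd0).filter_mono nhdsWithin_le_nhds,
      hev.filter_mono nhdsWithin_le_nhds] with k hk0 hk
    exact isUnit_of_eq_smul_one hk0 hk.1 hk.2.1
  rcases hcover 1 self_mem_Ici with h | h
  · exact h.self_of_nhds
  · obtain ⟨s, -, hsU, hsV⟩ := isPreconnected_Ici U V hU hV (fun s hs => hcover s hs)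
      ⟨s₁, hs₁, hs₁U⟩ ⟨1, self_mem_Ici, h⟩
    exact absurd hsU.self_of_nhds hsV.self_of_nhds

end Continuation

/-! ### Solvability, meromorphy and the limit at infinity. -/

section Solvability

open scoped BoundedContinuousFunction

variable {u : ℝ → ℝ → ℝ} {t : ℝ}

theorem analyticAt_systemOp (h : IsScatteringAt u t) (c : Fin 3) {k : ℂ} (hk : k ∈ contourᶜ) :
    AnalyticAt ℂ (systemOp h c) k :=
  analyticAt_columnOp h c (Λ := fun k j => lam j k) (fun _ hj => re_lam_ne hk hj.symm)
    (fun j => analyticAt_lam j (ne_zero_of_notMem_contour hk)) (analyticAt_coeffFst hk)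
    (analyticAt_coeffSnd hk)

theorem systemOp_mem_finiteRankLimits (h : IsScatteringAt u t) (c : Fin 3) {k : ℂ}
    (hk : k ∈ contourᶜ) :
    systemOp h c k ∈ finiteRankLimits (Fin 3 → (ℝ →ᵇ ℂ)) (Fin 3 → (ℝ →ᵇ ℂ)) :=
  columnOp_mem_finiteRankLimits h c (Λ := fun j => lam j k) _ _
    (fun _ hj => re_lam_ne hk hj.symm)

theorem eventually_norm_systemOp_le (h : IsScatteringAt u t) {ε : ℝ} (hε : 0 < ε) :
    ∀ᶠ k in Bornology.cobounded ℂ ⊓ 𝓟 contourᶜ, ∀ (c : Fin 3) (a : ℂ) (f : Fin 3 → (ℝ →ᵇ ℂ)),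
      f = unitColumn c a + systemOp h c k f → ‖systemOp h c k f‖ ≤ ε * ‖f‖ := by
  obtain ⟨η, R, hη, hR, H⟩ := exists_norm_columnOp_le h (C₀ := 6) (by norm_num) hε
  rw [eventually_inf_principal]
  filter_upwards [tendsto_norm_cobounded_atTop.eventually_ge_atTop
    (max 4 (max (4 / η) (2 * R)))] with k hkn hk
  have h4 : 4 ≤ ‖k‖ := (le_max_left _ _).trans hkn
  have hη' : 4 / η ≤ ‖k‖ := ((le_max_left _ _).trans (le_max_right _ _)).trans hkn
  have hR' : 2 * R ≤ ‖k‖ := ((le_max_right _ _).trans (le_max_right _ _)).trans hkn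
  obtain ⟨b1, b2, b3, b4⟩ := spectral_bounds hk h4
  have hle : 4 / ‖k‖ ≤ η := by
    rw [div_le_iff₀ (by linarith)]
    rw [div_le_iff₀ hη] at hη'
    linarith
  intro c a f hf
  exact H (fun j => lam j k) (coeffFst k) (coeffSnd k) b1 (fun j => (b2 j).trans hle)
    (fun j l => (b3 j l).trans hle) (fun j l hjl => le_trans (by linarith) (b4 j l hjl)) c a f hf

theorem eventually_injective (h : IsScatteringAt u t) :
    ∀ᶠ k in Bornology.cobounded ℂ ⊓ 𝓟 contourᶜ, ∀ (c : Fin 3) (f : Fin 3 → (ℝ →ᵇ ℂ)),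
      systemOp h c k f = f → f = 0 := by
  filter_upwards [eventually_norm_systemOp_le h one_half_pos] with k hk c f hf
  have h0 : unitColumn c 0 = 0 := by
    rw [unitColumn, show BoundedContinuousFunction.const ℝ (0 : ℂ) = 0 from rfl, Pi.single_zero]
  have h1 := hk c 0 f (by rw [h0, zero_add, hf])
  rw [hf] at h1
  exact norm_le_zero_iff.mp (by linarith)

/-- The Fredholm alternative: if the determinant vanished at `k`, there would be a nonzero fixed
vector. -/
theorem isUnit_of_injective (h : IsScatteringAt u t) (c : Fin 3) {k : ℂ} (hk : k ∈ contourᶜ)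
    (hinj : ∀ f, systemOp h c k f = f → f = 0) : IsUnit (1 - systemOp h c k) := by
  obtain ⟨d, G, -, -, hev⟩ := exists_analytic_inverse (analyticAt_systemOp h c hk)
    (systemOp_mem_finiteRankLimits h c hk)
  obtain ⟨h1, h2, h3⟩ := hev.self_of_nhds
  refine isUnit_of_eq_smul_one (fun hd => ?_) h1 h2
  obtain ⟨f, hf0, hf⟩ := h3 hd
  exact hf0 (hinj f hf)

theorem eventually_uniquelySolvable_cobounded (h : IsScatteringAt u t) :
    ∀ᶠ k in Bornology.cobounded ℂ ⊓ 𝓟 contourᶜ, UniquelySolvable u t k := by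
  filter_upwards [eventually_injective h, mem_inf_of_right (mem_principal_self _)] with k hinj hk
  exact uniquelySolvable_of_isUnit h hk fun c => isUnit_of_injective h c hk (hinj c)

/-- The path is the ray `s k₀`, `s ≥ 1`: it stays off the contour by scaling invariance and reaches
the region where injectivity is known. -/
theorem eventually_isUnit_systemOp (h : IsScatteringAt u t) (c : Fin 3) {k₀ : ℂ}
    (hk₀ : k₀ ∈ contourᶜ) : ∀ᶠ k in 𝓝[≠] k₀, IsUnit (1 - systemOp h c k) := by
  have hk0 := ne_zero_of_notMem_contour hk₀
  have hmem : ∀ s ∈ Ici (1 : ℝ), (s : ℂ) * k₀ ∈ contourᶜ := fun s hs =>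
    smul_mem_contour_compl hk₀ (one_pos.trans_le hs)
  have htend : Tendsto (fun s : ℝ => (s : ℂ) * k₀) atTop (Bornology.cobounded ℂ ⊓ 𝓟 contourᶜ) := by
    refine tendsto_inf.mpr ⟨?_, tendsto_principal.mpr ?_⟩
    · rw [← tendsto_norm_atTop_iff_cobounded]
      simp only [norm_mul, Complex.norm_real]
      exact (tendsto_norm_atTop_atTop).atTop_mul_const (norm_pos_iff.mpr hk0)
    · filter_upwards [eventually_ge_atTop 1] with s hs using hmem s hs
  have hpath := eventually_isUnit_of_path (A := systemOp h c) (γ := fun s : ℝ => (s : ℂ) * k₀)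
    (by fun_prop) (fun s hs => analyticAt_systemOp h c (hmem s hs))
    (fun s hs => systemOp_mem_finiteRankLimits h c (hmem s hs)) (by
      obtain ⟨s, hs, hs1⟩ := ((htend.eventually (eventually_injective h)).and
        (eventually_ge_atTop 1)).exists
      exact ⟨s, hs1, hs c⟩)
  simpa using hpath

theorem eventually_uniquelySolvable (h : IsScatteringAt u t) {k₀ : ℂ} (hk₀ : k₀ ∈ contourᶜ) :
    ∀ᶠ k in 𝓝[≠] k₀, UniquelySolvable u t k := by
  filter_upwards [eventually_all.mpr fun c => eventually_isUnit_systemOp h c hk₀,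
    (eventually_notMem_contour hk₀).filter_mono nhdsWithin_le_nhds] with k hu hk
  exact uniquelySolvable_of_isUnit h hk hu

/-- Applying `G` to `(1 - K_c) f = e_c` gives `d f = G e_c`, so each entry of column `c` is a
quotient of analytic functions near `k₀`. -/
theorem meromorphicAt_of_solves (h : IsScatteringAt u t) {k₀ : ℂ} (hk₀ : k₀ ∈ contourᶜ)
    {M : ℝ → ℂ → Matrix (Fin 3) (Fin 3) ℂ}
    (hM : ∀ᶠ k in 𝓝[≠] k₀, SolvesIntegralSystem u t k fun x => M x k) (x : ℝ) (j c : Fin 3) :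
    MeromorphicAt (fun k => M x k j c) k₀ := by
  obtain ⟨d, G, hd, hG, hev⟩ := exists_analytic_inverse (analyticAt_systemOp h c hk₀)
    (systemOp_mem_finiteRankLimits h c hk₀)
  have hd0 : ∀ᶠ k in 𝓝[≠] k₀, d k ≠ 0 := by
    refine hd.eventually_eq_zero_or_eventually_ne_zero.resolve_left fun h0 => ?_
    obtain ⟨k, hu, hk0, hk⟩ := ((eventually_isUnit_systemOp h c hk₀).and
      ((h0.and hev).filter_mono nhdsWithin_le_nhds)).exists
    obtain ⟨f, hf0, hf⟩ := hk.2.2 hk0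
    have h1 : (1 - systemOp h c k) f = 0 := by rw [sub_apply, one_apply_eq_self, hf, sub_self]
    have h2 := congrArg (fun S => S f) (Ring.inverse_mul_cancel _ hu)
    refine hf0 ?_
    simpa [h1] using h2.symm
  have hG' : AnalyticAt ℂ (fun k => G k (unitColumn c 1) j x) k₀ := by
    have h1 := AnalyticAt.fun_comp_of_eq
      ((((BoundedContinuousFunction.evalCLM ℂ x).comp
        (ContinuousLinearMap.proj (R := ℂ) (φ := fun _ : Fin 3 => ℝ →ᵇ ℂ) j)).comp
        (ContinuousLinearMap.apply ℂ (Fin 3 → (ℝ →ᵇ ℂ)) (unitColumn c 1))).analyticAt _) hG rfl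
    exact h1
  refine (hd.meromorphicAt.inv.mul hG'.meromorphicAt).congr ?_
  filter_upwards [hd0, hev.filter_mono nhdsWithin_le_nhds, hM,
    (eventually_notMem_contour hk₀).filter_mono nhdsWithin_le_nhds] with k hdk hk hs hkc
  obtain ⟨f, hfM, hf⟩ := hs.exists_column h hkc c
  have h1 : (1 - systemOp h c k) f = unitColumn c 1 := by
    rw [sub_apply, one_apply_eq_self, sub_eq_iff_eq_add]
    exact hf
  have h2 := congrArg (fun S => S f) hk.2.1
  simp only [mul_apply_eq_comp, h1, smul_apply, one_apply_eq_self] at h2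
  simp only [Pi.mul_apply, Pi.inv_apply]
  rw [h2, ← hfM x j, Pi.smul_apply, BoundedContinuousFunction.smul_apply, smul_eq_mul,
    inv_mul_cancel_left₀ hdk]

theorem norm_unitColumn_one_le (c : Fin 3) : ‖unitColumn c 1‖ ≤ 1 := by
  refine (pi_norm_le_iff_of_nonneg zero_le_one).mpr fun j => ?_
  refine (BoundedContinuousFunction.norm_le zero_le_one).mpr fun x => ?_
  rw [unitColumn_one_apply, Matrix.one_apply]
  split_ifs <;> simp

theorem tendsto_of_solves (h : IsScatteringAt u t) {M : ℝ → ℂ → Matrix (Fin 3) (Fin 3) ℂ}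
    (hM : ∀ᶠ k in Bornology.cobounded ℂ ⊓ 𝓟 contourᶜ, SolvesIntegralSystem u t k fun x => M x k)
    (x : ℝ) : Tendsto (fun k => M x k) (Bornology.cobounded ℂ ⊓ 𝓟 contourᶜ) (𝓝 1) := by
  refine tendsto_pi_nhds.mpr fun j => tendsto_pi_nhds.mpr fun c => ?_
  refine Metric.tendsto_nhds.mpr fun ε hε => ?_
  set δ := min (1 / 2) (ε / 4)
  have hδ : 0 < δ := lt_min one_half_pos (by positivity)
  have hδ1 : δ ≤ 1 / 2 := min_le_left _ _
  have hδ2 : δ ≤ ε / 4 := min_le_right _ _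
  filter_upwards [eventually_norm_systemOp_le h hδ, hM,
    mem_inf_of_right (mem_principal_self _)] with k hk hs hkc
  obtain ⟨f, hfM, hf⟩ := hs.exists_column h hkc c
  have h1 := hk c 1 f hf
  have h2 : ‖f‖ ≤ 1 + ‖systemOp h c k f‖ := by
    calc ‖f‖ = ‖unitColumn c 1 + systemOp h c k f‖ := by rw [← hf]
      _ ≤ 1 + ‖systemOp h c k f‖ :=
        (norm_add_le _ _).trans (add_le_add_left (norm_unitColumn_one_le c) _)
  -- From `‖f‖ ≤ 1 + ‖f‖/2`, since `δ ≤ 1/2`; then `‖K_c f‖ ≤ 2δ ≤ ε/2`.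
  have h3 : ‖f‖ ≤ 2 := by nlinarith [norm_nonneg f]
  have h4 : M x k j c - (1 : Matrix (Fin 3) (Fin 3) ℂ) j c = systemOp h c k f j x := by
    rw [← hfM x j, ← unitColumn_one_apply c j x, sub_eq_iff_eq_add']
    conv_lhs => rw [hf]
    rfl
  rw [dist_eq_norm, h4]
  have h5 : ‖systemOp h c k f j x‖ ≤ ‖systemOp h c k f‖ :=
    (BoundedContinuousFunction.norm_coe_le_norm _ x).trans (norm_le_pi_norm _ j)
  nlinarith [norm_nonneg f]

end Solvability

end DegasperisProcesi

theorem mainTheorem3 (u₀ : ℝ → ℝ) (u : ℝ → ℝ → ℝ)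
    (hu : DegasperisProcesi.IsSolution u₀ u)
    (hpos : ∀ x : ℝ, 0 < u₀ x - iteratedDeriv 2 u₀ x + 1) :
    -- off the contour the solution is defined outside a set without accumulation points there
    (∀ t : ℝ, 0 ≤ t → ∀ k₀ ∈ DegasperisProcesi.contourᶜ,
      ∀ᶠ k in 𝓝[≠] k₀, DegasperisProcesi.UniquelySolvable u t k) ∧
    -- and it is defined for all large `k` off the contour
    (∀ t : ℝ, 0 ≤ t →
      ∀ᶠ k in Bornology.cobounded ℂ ⊓ 𝓟 DegasperisProcesi.contourᶜ,
        DegasperisProcesi.UniquelySolvable u t k) ∧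
    ∀ M : ℝ → ℝ → ℂ → Matrix (Fin 3) (Fin 3) ℂ, DegasperisProcesi.IsEigenfunction u M →
      ∀ x t : ℝ, 0 ≤ t →
        DegasperisProcesi.IsPiecewiseMeromorphic DegasperisProcesi.contour
          (fun k => M x t k) ∧
        Tendsto (fun k => M x t k) (Bornology.cobounded ℂ ⊓ 𝓟 DegasperisProcesi.contourᶜ)
          (𝓝 1) := by
  have hsc : ∀ t : ℝ, 0 ≤ t → DegasperisProcesi.IsScatteringAt u t := fun t ht =>
    hu.isScattering hpos ht
  refine ⟨fun t ht k₀ hk₀ => DegasperisProcesi.eventually_uniquelySolvable (hsc t ht) hk₀,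
    fun t ht => DegasperisProcesi.eventually_uniquelySolvable_cobounded (hsc t ht),
    fun M hM x t ht => ⟨fun j c k₀ hk₀ => ?_, ?_⟩⟩
  · refine DegasperisProcesi.meromorphicAt_of_solves (hsc t ht) hk₀ (M := fun x k => M x t k)
      ?_ x j c
    filter_upwards [DegasperisProcesi.eventually_uniquelySolvable (hsc t ht) hk₀,
      (DegasperisProcesi.eventually_notMem_contour hk₀).filter_mono nhdsWithin_le_nhds]
      with k hk hkc
    exact hM t ht k hkc hk
  · refine DegasperisProcesi.tendsto_of_solves (hsc t ht) (M := fun x k => M x t k) ?_ x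
    filter_upwards [DegasperisProcesi.eventually_uniquelySolvable_cobounded (hsc t ht),
      mem_inf_of_right (mem_principal_self _)] with k hk hkc
    exact hM t ht k hkc hk
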